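/- Let $\mathbb{C}^2$ carry the symplectic form $\omega=dx_1\wedge dy_1+dx_2\wedge dy_2$, and put $L(m,n)=\{(z_1,z_2)\in\mathbb{C}^2 : \pi|z_1|^2=m,\ \pi|z_2|^2=n\}$, $P(a,b)=\{(z_1,z_2)\in\mathbb{C}^2 : \pi|z_1|^2<a,\ \pi|z_2|^2<b\}$, $C=\{z\in\mathbb{C} : \pi|z|^2=1\}$ and $D(a)=\{z\in\mathbb{C} : \pi|z|^2<a\}$. An integral Lagrangian in $P(a,b)$ is a closed (compact, without boundary), connected, embedded Lagrangian submanifold $L\subset P(a,b)$ whose area homomorphism $H_2(P(a,b),L;\mathbb{Z})\to\mathbb{R}$, $[c]\mapsto\int_c\omega$, takes only integer values. The integral packing of $P(a,b)$ by the tori $L(m,n)$, where $m,n\ge 1$ are integers with $m<a$ and $n<b$, is called maximal if every integral Lagrangian in $P(a,b)$ intersects some such $L(m,n)$. Let $a>1$ and $b>2$. Then the integral packing of $P(a,b)$ by $\{L(m,n)\}$ is not maximal. Moreover, for every $\delta>0$ there are a curve $C'\subset D(a)$, the image of $C$ under the time-one map of a time-dependent Hamiltonian with compact support in $D(a)\cap\{z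 : |\pi|z|^2-1|<\delta\}$, which meets $C$ transversely in exactly two points, and an integral Lagrangian $L$ in $P(a,b)$ such that, with $L(1,1)'=C'\times C$, (i) $L$ is the image of $L(1,1)$ under the time-one map of a time-dependent Hamiltonian with compact support in $P(a,b)$; (ii) $L\cap L(1,1)'=\emptyset$; (iii) $L\cap L(m,n)=\emptyset$ for all integers $m,n\ge1$ with $(m,n)\neq(1,1)$. -/

import Mathlib

open scoped ContDiff Topology

noncomputable section

/-- The standard area form `dx ∧ dy` on `ℂ`. -/
def areaForm (u v : ℂ) : ℝ := u.re * v.im - u.im * v.re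

/-- The standard symplectic form `dx₁ ∧ dy₁ + dx₂ ∧ dy₂` on `ℂ²`. -/
def symplForm (u v : ℂ × ℂ) : ℝ := areaForm u.1 v.1 + areaForm u.2 v.2

/-- The circle centred at `0` bounding a disk of area `c`. -/
def areaCircle (c : ℝ) : Set ℂ := {z | Real.pi * ‖z‖ ^ 2 = c}

/-- The open disk centred at `0` of area `c`. -/
def areaDisk (c : ℝ) : Set ℂ := {z | Real.pi * ‖z‖ ^ 2 < c}

/-- The product torus `L(m, n) ⊆ ℂ²`. -/
def productTorus (m n : ℝ) : Set (ℂ × ℂ) :=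
  {z | Real.pi * ‖z.1‖ ^ 2 = m ∧ Real.pi * ‖z.2‖ ^ 2 = n}

/-- The open polydisk `P(a, b) ⊆ ℂ²`. -/
def polydisk (a b : ℝ) : Set (ℂ × ℂ) :=
  {z | Real.pi * ‖z.1‖ ^ 2 < a ∧ Real.pi * ‖z.2‖ ^ 2 < b}

section General

variable {E : Type*} [NormedAddCommGroup E] [NormedSpace ℝ E]

/-- `S` is an embedded smooth submanifold of dimension `k` of `E` (without boundary): around each
of its points some smooth chart of `E` straightens `S` to a `k`-dimensional linear subspace. -/
def IsSmoothSubmanifold (k : ℕ) (S : Set E) : Prop :=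
  ∀ p ∈ S, ∃ (Φ : OpenPartialHomeomorph E E) (F : Submodule ℝ E),
    p ∈ Φ.source ∧ ContDiffOn ℝ ∞ Φ Φ.source ∧ ContDiffOn ℝ ∞ Φ.symm Φ.target ∧
    Module.finrank ℝ F = k ∧ ∀ q ∈ Φ.source, q ∈ S ↔ Φ q ∈ F

/-- The tangent vectors of `S` at `p`: velocities at time `0` of smooth curves through `p`
that run in `S`. -/
def tangentVectors (S : Set E) (p : E) : Set E :=
  {v | ∃ γ : ℝ → E, ContDiff ℝ ∞ γ ∧ γ 0 = p ∧ deriv γ 0 = v ∧ ∀ᶠ t in 𝓝 (0 : ℝ), γ t ∈ S}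

/-- `S` and `T` intersect transversely: their tangent spaces span `E` at every common point. -/
def IntersectTransversely (S T : Set E) : Prop :=
  ∀ p ∈ S ∩ T, ∀ w : E, ∃ u ∈ tangentVectors S p, ∃ v ∈ tangentVectors T p, u + v = w

/-- `φ` is the flow of the smooth time-dependent Hamiltonian `H` for the constant symplectic form
`Ω` on `E`, and `H` has compact support in `U`. The velocity `V` of the flow is the Hamiltonian
vector field, given by `Ω(V, ·) = dH_t`. -/
structure IsHamiltonianFlow (Ω : E → E → ℝ) (U : Set E) (H : ℝ → E → ℝ) (φ : ℝ → E → E) :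
    Prop where
  smooth : ContDiff ℝ ∞ (fun p : ℝ × E => H p.1 p.2)
  compact_support : ∃ K : Set E, IsCompact K ∧ K ⊆ U ∧ ∀ t, ∀ x ∉ K, H t x = 0
  initial : ∀ x, φ 0 x = x
  flow : ∀ t x, ∃ V : E, HasDerivAt (fun s => φ s x) V t ∧
    ∀ w, Ω V w = fderiv ℝ (H t) (φ t x) w

/-- `S₁` is the image of `S₀` under the time-one map of a Hamiltonian with compact support
in `U`. -/
def HamiltonianIsotopic (Ω : E → E → ℝ) (U S₀ S₁ : Set E) : Prop :=
  ∃ (H : ℝ → E → ℝ) (φ : ℝ → E → E), IsHamiltonianFlow Ω U H φ ∧ φ 1 '' S₀ = S₁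

/-- The standard 2-simplex, with vertices `v₀ = (0,0)`, `v₁ = (1,0)`, `v₂ = (0,1)`. -/
def stdTriangle : Set (ℝ × ℝ) := {p | 0 ≤ p.1 ∧ 0 ≤ p.2 ∧ p.1 + p.2 ≤ 1}

/-- A smooth singular 2-simplex in `U`, given through a smooth extension to the whole plane.
Only its restriction to the standard simplex enters the notions below. -/
structure SmoothTriangle (U : Set E) where
  toFun : ℝ × ℝ → E
  smooth : ContDiff ℝ ∞ toFun
  mapsTo : ∀ p ∈ stdTriangle, toFun p ∈ U

/-- The integral of `Ω` over a smooth singular 2-simplex. -/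
def SmoothTriangle.area (Ω : E → E → ℝ) {U : Set E} (σ : SmoothTriangle U) : ℝ :=
  ∫ p in stdTriangle, Ω (fderiv ℝ σ.toFun p (1, 0)) (fderiv ℝ σ.toFun p (0, 1))

/-- The face `[v₁, v₂]`. -/
def SmoothTriangle.face₀ {U : Set E} (σ : SmoothTriangle U) : unitInterval → E :=
  fun t => σ.toFun (1 - (t : ℝ), (t : ℝ))

/-- The face `[v₀, v₂]`. -/
def SmoothTriangle.face₁ {U : Set E} (σ : SmoothTriangle U) : unitInterval → E :=
  fun t => σ.toFun (0, (t : ℝ))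

/-- The face `[v₀, v₁]`. -/
def SmoothTriangle.face₂ {U : Set E} (σ : SmoothTriangle U) : unitInterval → E :=
  fun t => σ.toFun ((t : ℝ), 0)

/-- The integral of `Ω` over a smooth singular 2-chain with integer coefficients. -/
def chainArea (Ω : E → E → ℝ) {U : Set E} (c : SmoothTriangle U →₀ ℤ) : ℝ :=
  c.sum fun σ n => (n : ℝ) * σ.area Ω

/-- The boundary of a smooth singular 2-chain. -/
def chainBoundary {U : Set E} (c : SmoothTriangle U →₀ ℤ) : (unitInterval → E) →₀ ℤ :=
  c.sum fun σ n =>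
    Finsupp.single σ.face₀ n - Finsupp.single σ.face₁ n + Finsupp.single σ.face₂ n

/-- The 2-chain `c` in `U` is a relative cycle modulo `L`, so that it represents a class in
`H₂(U, L; ℤ)`: its boundary is a chain of paths in `L`. -/
def IsRelativeCycle {U : Set E} (L : Set E) (c : SmoothTriangle U →₀ ℤ) : Prop :=
  ∀ γ ∈ (chainBoundary c).support, ∀ t, γ t ∈ L

/-- The area homomorphism `H₂(U, L; ℤ) → ℝ`, `[c] ↦ ∫_c Ω`, takes only integer values. -/
def HasIntegralAreas (Ω : E → E → ℝ) (U L : Set E) : Prop :=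
  ∀ c : SmoothTriangle U →₀ ℤ, IsRelativeCycle L c → ∃ k : ℤ, chainArea Ω c = k

end General

/-- `L` is a closed (compact, without boundary) connected Lagrangian submanifold of the open set
`U ⊆ ℂ²`. -/
structure IsClosedLagrangian (U L : Set (ℂ × ℂ)) : Prop where
  subset : L ⊆ U
  compact : IsCompact L
  connected : IsConnected L
  submanifold : IsSmoothSubmanifold 2 L
  lagrangian : ∀ p ∈ L, ∀ u ∈ tangentVectors L p, ∀ v ∈ tangentVectors L p, symplForm u v = 0

/-- `L` is an integral Lagrangian in `U`. -/
def IsIntegralLagrangian (U L : Set (ℂ × ℂ)) : Prop :=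
  IsClosedLagrangian U L ∧ HasIntegralAreas symplForm U L

/-- The integral packing of `P(a, b)` by the product tori `L(m, n)`, with `m, n` positive integers,
`m < a` and `n < b`, is maximal: every integral Lagrangian in `P(a, b)` meets one of them. -/
def IsMaximalIntegralPacking (a b : ℝ) : Prop :=
  ∀ L : Set (ℂ × ℂ), IsIntegralLagrangian (polydisk a b) L →
    ∃ m n : ℕ, 1 ≤ m ∧ 1 ≤ n ∧ (m : ℝ) < a ∧ (n : ℝ) < b ∧ (L ∩ productTorus m n).Nonempty

end

/-!
Write `μᵢ = π |zᵢ|²` and `uᵢ = zᵢ / |zᵢ|`; in area and angle coordinates the symplectic form is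
`∑ dμᵢ ∧ dθᵢ / 2π`. For every small `ε > 0` there is an explicit Lagrangian torus, the
`twistedTorus ε`, that is Hamiltonian isotopic to `L(1, 1)` inside `{μ₁ < 1 + 3 ε, μ₂ < 2 + ε / 10}`
and meets none of the tori `L(m, n)`, not even `L(1, 1)`.

In the second factor the circle of area `1` is first deformed into a curve that encloses area `1`
but avoids the half-line `(-∞, 0]`: a thin notch is cut along the negative axis and the curve is
shifted a little (`slitPt_mem_slitPlane`). On the slit plane the angle `arg z₂` is a function, so
that `V(u₁) arg z₂ / 2π`, with `V = pushArea ≈ 1 + (ε / 20) Re u₁`, is a Hamiltonian there. Its flow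
pushes the curve outwards, to values of `μ₂` in an interval of length slightly more than `1` centred
at `3 / 2 + (ε / 20) Re u₁`, and changes `μ₁` by at most `4 ε / 25`. The circle `μ₂ = 1` is now met
only where `Re u₁` is nearly nonpositive, the circle `μ₂ = 2` only where `Re u₁` is nearly
nonnegative, and the circles `μ₂ = n` with `n ≥ 3` not at all. A second flow, whose Hamiltonian is
the sum of `-W(u₁) (μ₂ - 3 / 2) / 2π`, with `W = twistAngle = -ε Re u₁ Im u₁`, and of a multiple of
`Im u₁`, preserves `μ₂` and changes `μ₁` by `twistRate`, which is
`ε ((Re u₁)² - Re u₁ - 1 / 2)` over `μ₂ = 2` and `ε (1 / 2 - (Re u₁)² - Re u₁)` over `μ₂ = 1`. In the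
relevant ranges of `Re u₁` this is at most `-39 ε / 100` and at least `39 ε / 100`, respectively.
Hence `μ₁ ≤ 1 - ε / 5` over `μ₂ = 2` and `μ₁ ≥ 1 + ε / 5` over `μ₂ = 1`
(`innerArea_le_of_outerArea_eq_two`, `innerArea_ge_of_outerArea_eq_one`). As `|μ₁ - 1| < 3 ε`
everywhere, the torus misses all `L(m, n)` (`disjoint_twistedTorus_productTorus`), and it also misses
`C' × C` for the curve `C' = {μ = 1 + k Re u}` with `k < ε / 5`
(`disjoint_twistedTorus_displacedCircle`).

The Hamiltonians are only defined near the trajectories of the torus. Cutting them off and solving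
the resulting bounded Lipschitz equation globally turns the explicit families of tori into
Hamiltonian isotopies (`HamiltonianIsotopic.of_trajectories`), which are then concatenated
(`HamiltonianIsotopic.trans`).

That the torus is Lagrangian with integral areas is not deduced from the isotopy but read off from
a primitive: the pullback of `½ ω(x, dx)` under the doubly periodic parametrisation is the
differential of an explicit function, which is `x₁ + x₂` plus a periodic function
(`primitive_twistedTorus`). The form `ω` therefore vanishes on the torus
(`eq_zero_of_primitive_exact`), and by Stokes' theorem for smooth triangles the area of a relative
cycle is the integral of `½ ω(x, dx)` over its boundary, which is an integer because the primitive
is well defined modulo integers (`hasIntegralAreas_of_primitive`). A smooth local inverse of the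
parametrisation yields straightening charts (`IsSubmanifoldParam.isSmoothSubmanifold`).
-/

/-! ### Hamiltonian isotopies from explicit trajectories -/

/-- A bounded Lipschitz vector field on a Banach space is complete. -/
theorem exists_global_flow {E : Type*} [NormedAddCommGroup E] [NormedSpace ℝ E] [CompleteSpace E]
    {X : E → E} {K M : NNReal} (hK : LipschitzWith K X) (hM : ∀ x, ‖X x‖ ≤ M) :
    ∃ φ : ℝ → E → E, (∀ x, φ 0 x = x) ∧ ∀ t x, HasDerivAt (fun s => φ s x) (X (φ t x)) t := by
  have key : ∀ (x : E) (T : ℝ), 0 < T → ∃ α : ℝ → E, α 0 = x ∧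
      ∀ t ∈ Set.Ioo (-T) T, HasDerivAt α (X (α t)) t := by
    intro x T hT
    have h0 : (0 : ℝ) ∈ Set.Icc (-T) T := ⟨by linarith, hT.le⟩
    have hP : IsPicardLindelof (fun _ : ℝ => X) (⟨0, h0⟩ : Set.Icc (-T) T) x
        (M * T.toNNReal) 0 M K := by
      refine IsPicardLindelof.of_time_independent (fun y _ => hM y) hK.lipschitzOnWith ?_
      simp [hT.le]
    obtain ⟨α, h1, h2⟩ := hP.exists_eq_forall_mem_Icc_hasDerivWithinAt₀
    exact ⟨α, h1, fun t ht => (h2 t ⟨ht.1.le, ht.2.le⟩).hasDerivAt (Icc_mem_nhds ht.1 ht.2)⟩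
  choose! α hα0 hα using key
  have uniq : ∀ x T T' t, 0 < T → T ≤ T' → t ∈ Set.Ioo (-T) T → α x T t = α x T' t := by
    intro x T T' t hT hTT ht
    have h0 : (0 : ℝ) ∈ Set.Ioo (-T) T := ⟨by linarith, hT⟩
    have := ODE_solution_unique_of_mem_Ioo (v := fun _ => X) (s := fun _ => Set.univ) (K := K)
      (f := α x T) (g := α x T')
      (fun _ _ => hK.lipschitzOnWith) h0
      (fun t ht => ⟨hα x T hT t ht, trivial⟩)
      (fun t ht => ⟨hα x T' (by linarith) t ⟨by linarith [ht.1], by linarith [ht.2]⟩, trivial⟩)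
      (by rw [hα0 x T hT, hα0 x T' (by linarith)])
    exact this ht
  have hmem : ∀ t : ℝ, t ∈ Set.Ioo (-(|t| + 1)) (|t| + 1) := fun t =>
    ⟨by linarith [neg_abs_le t], by linarith [le_abs_self t]⟩
  refine ⟨fun t x => α x (|t| + 1) t, fun x => ?_, fun t x => ?_⟩
  · exact hα0 x _ (by positivity)
  · have hlt : 0 < |t| + 2 := by positivity
    have ht2 : t ∈ Set.Ioo (-(|t| + 2)) (|t| + 2) :=
      ⟨by linarith [(hmem t).1], by linarith [(hmem t).2]⟩
    have e1 : α x (|t| + 1) t = α x (|t| + 2) t :=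
      uniq x _ _ t (by positivity) (by linarith) (hmem t)
    have hd := hα x (|t| + 2) hlt t ht2
    simp only [e1]
    refine hd.congr_of_eventuallyEq ?_
    filter_upwards [Ioo_mem_nhds (hmem t).1 (hmem t).2] with s hs
    have hs' : |s| < |t| + 1 := abs_lt.2 hs
    exact uniq x _ _ s (by positivity) (by linarith) (hmem s)

section Isotopy

variable {E : Type*} [NormedAddCommGroup E] [NormedSpace ℝ E]

/-- Hamiltonian isotopies can be performed one after the other: both flows are reparametrised so
that the first one rests after time `1/3` and the second one before time `2/3`. -/
theorem HamiltonianIsotopic.trans {Ω : E → E → ℝ} {B : E →L[ℝ] E →L[ℝ] ℝ}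
    (hΩ : ∀ u v, Ω u v = B u v) {U S₀ S₁ S₂ : Set E}
    (h₁ : HamiltonianIsotopic Ω U S₀ S₁) (h₂ : HamiltonianIsotopic Ω U S₁ S₂) :
    HamiltonianIsotopic Ω U S₀ S₂ := by
  obtain ⟨H₁, φ₁, hf₁, hS₁⟩ := h₁
  obtain ⟨H₂, φ₂, hf₂, hS₂⟩ := h₂
  set β₁ : ℝ → ℝ := fun t => Real.smoothTransition (3 * t) with hβ₁
  set β₂ : ℝ → ℝ := fun t => Real.smoothTransition (3 * t - 2) with hβ₂
  have sm₁ : ContDiff ℝ ∞ β₁ := Real.smoothTransition.contDiff.comp (by fun_prop)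
  have sm₂ : ContDiff ℝ ∞ β₂ := Real.smoothTransition.contDiff.comp (by fun_prop)
  have one₁ : ∀ t, 1 / 3 ≤ t → β₁ t = 1 := fun t ht =>
    Real.smoothTransition.one_of_one_le (by linarith)
  have zero₂ : ∀ t, t ≤ 2 / 3 → β₂ t = 0 := fun t ht =>
    Real.smoothTransition.zero_of_nonpos (by linarith)
  have zero₁ : β₁ 0 = 0 := Real.smoothTransition.zero_of_nonpos (by norm_num)
  have one₂ : β₂ 1 = 1 := Real.smoothTransition.one_of_one_le (by norm_num)
  have dsm₁ : ContDiff ℝ ∞ (deriv β₁) := (contDiff_infty_iff_deriv.1 sm₁).2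
  have dsm₂ : ContDiff ℝ ∞ (deriv β₂) := (contDiff_infty_iff_deriv.1 sm₂).2
  have d₁ : ∀ t, HasDerivAt β₁ (deriv β₁ t) t := fun t =>
    ((sm₁.differentiable (by simp)) t).hasDerivAt
  have d₂ : ∀ t, HasDerivAt β₂ (deriv β₂ t) t := fun t =>
    ((sm₂.differentiable (by simp)) t).hasDerivAt
  have diff₁ : ∀ s, Differentiable ℝ (H₁ s) := fun s =>
    (hf₁.smooth.comp (contDiff_const.prodMk contDiff_id)).differentiable (by simp)
  have diff₂ : ∀ s, Differentiable ℝ (H₂ s) := fun s =>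
    (hf₂.smooth.comp (contDiff_const.prodMk contDiff_id)).differentiable (by simp)
  refine ⟨fun t x => deriv β₁ t * H₁ (β₁ t) x + deriv β₂ t * H₂ (β₂ t) x,
    fun t x => φ₂ (β₂ t) (φ₁ (β₁ t) x), ⟨?_, ?_, ?_, ?_⟩, ?_⟩
  · refine ContDiff.add ?_ ?_
    · exact (dsm₁.comp contDiff_fst).mul
        (hf₁.smooth.comp ((sm₁.comp contDiff_fst).prodMk contDiff_snd))
    · exact (dsm₂.comp contDiff_fst).mul
        (hf₂.smooth.comp ((sm₂.comp contDiff_fst).prodMk contDiff_snd))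
  · obtain ⟨K₁, hK₁, hU₁, hz₁⟩ := hf₁.compact_support
    obtain ⟨K₂, hK₂, hU₂, hz₂⟩ := hf₂.compact_support
    refine ⟨K₁ ∪ K₂, hK₁.union hK₂, Set.union_subset hU₁ hU₂, fun t x hx => ?_⟩
    rw [Set.mem_union, not_or] at hx
    simp [hz₁ _ _ hx.1, hz₂ _ _ hx.2]
  · intro x
    simp [zero₁, zero₂ 0 (by norm_num), hf₁.initial, hf₂.initial]
  · intro t x
    have hfd : ∀ y w, fderiv ℝ (fun x => deriv β₁ t * H₁ (β₁ t) x + deriv β₂ t * H₂ (β₂ t) x) y w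
        = deriv β₁ t * fderiv ℝ (H₁ (β₁ t)) y w + deriv β₂ t * fderiv ℝ (H₂ (β₂ t)) y w := by
      intro y w
      have h := (((diff₁ (β₁ t)) y).hasFDerivAt.const_mul (deriv β₁ t)).add
        (((diff₂ (β₂ t)) y).hasFDerivAt.const_mul (deriv β₂ t))
      have h' := h.fderiv
      simp only [Pi.add_def] at h'
      rw [h']
      simp
    rcases lt_or_ge t (1 / 2) with ht | ht
    · obtain ⟨V, hV, hVw⟩ := hf₁.flow (β₁ t) x
      have ev : ∀ᶠ s in 𝓝 t, β₂ s = 0 := by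
        filter_upwards [Iio_mem_nhds ht] with s hs
        exact zero₂ s (by have : s < 1 / 2 := hs; linarith)
      have hd0 : deriv β₂ t = 0 := by
        have : β₂ =ᶠ[𝓝 t] fun _ => (0 : ℝ) := ev
        rw [this.deriv_eq]; simp
      refine ⟨deriv β₁ t • V, ?_, fun w => ?_⟩
      · refine (hV.scomp t (d₁ t)).congr_of_eventuallyEq ?_
        filter_upwards [ev] with s hs
        simp [hs, hf₂.initial]
      · rw [hfd, hd0, ev.self_of_nhds, hf₂.initial, hΩ]
        simp [← hVw, hΩ]
    · obtain ⟨V, hV, hVw⟩ := hf₂.flow (β₂ t) (φ₁ 1 x)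
      have ev : ∀ᶠ s in 𝓝 t, β₁ s = 1 := by
        filter_upwards [Ioi_mem_nhds (show (1 / 3 : ℝ) < t by linarith)] with s hs
        exact one₁ s (le_of_lt hs)
      have hd0 : deriv β₁ t = 0 := by
        have : β₁ =ᶠ[𝓝 t] fun _ => (1 : ℝ) := ev
        rw [this.deriv_eq]; simp
      refine ⟨deriv β₂ t • V, ?_, fun w => ?_⟩
      · refine (hV.scomp t (d₂ t)).congr_of_eventuallyEq ?_
        filter_upwards [ev] with s hs
        simp [hs]
      · rw [hfd, hd0, ev.self_of_nhds, hΩ]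
        simp [← hVw, hΩ]
  · simp only [one₂, one₁ 1 (by norm_num)]
    rw [← hS₂, ← hS₁, Set.image_image]

/-- A smooth function on an open set agrees near a compact subset with a compactly supported
smooth function on the whole space. -/
theorem exists_contDiff_cutoff [FiniteDimensional ℝ E] {W K : Set E} (hW : IsOpen W)
    (hK : IsCompact K) (hKW : K ⊆ W) {H : E → ℝ} (hH : ContDiffOn ℝ ∞ H W) :
    ∃ (G : E → ℝ) (K' : Set E), ContDiff ℝ ∞ G ∧ IsCompact K' ∧ K' ⊆ W ∧ (∀ x ∉ K', G x = 0) ∧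
      ∀ x ∈ K, G =ᶠ[𝓝 x] H := by
  obtain ⟨K₂, hK₂, hKK₂, hK₂W⟩ := exists_compact_between hK hW hKW
  obtain ⟨K₁, hK₁, hKK₁, hK₁₂⟩ := exists_compact_between hK isOpen_interior hKK₂
  obtain ⟨χ, hχ, -, hsupp, hone⟩ := exists_contMDiff_support_eq_eq_one_iff (n := (⊤ : ℕ∞))
    (modelWithCornersSelf ℝ E) (isOpen_interior (s := K₂)) hK₁.isClosed hK₁₂
  have hχ' : ContDiff ℝ ∞ χ := hχ.contDiff
  have hzero : ∀ x ∉ K₂, χ x = 0 := by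
    intro x hx
    by_contra hne
    have : x ∈ Function.support χ := hne
    rw [hsupp] at this
    exact hx (interior_subset this)
  refine ⟨fun x => χ x * H x, K₂, ?_, hK₂, hK₂W, fun x hx => by simp [hzero x hx], fun x hx => ?_⟩
  · rw [contDiff_iff_contDiffAt]
    intro x
    by_cases hx : x ∈ W
    · exact hχ'.contDiffAt.mul (hH.contDiffAt (hW.mem_nhds hx))
    · have : (fun x => χ x * H x) =ᶠ[𝓝 x] fun _ => 0 := by
        filter_upwards [hK₂.isClosed.isOpen_compl.mem_nhds (fun h => hx (hK₂W h))] with y hy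
        simp [hzero y hy]
      exact contDiffAt_const.congr_of_eventuallyEq this
  · filter_upwards [isOpen_interior.mem_nhds (hKK₁ hx)] with y hy
    simp [(hone y).1 (interior_subset hy)]

/-- Explicit trajectories of an autonomous Hamiltonian that is defined near them only generate a
Hamiltonian isotopy: the Hamiltonian is cut off away from the trajectories, and the flow of the
cut-off Hamiltonian follows them by uniqueness of solutions. -/
theorem HamiltonianIsotopic.of_trajectories [FiniteDimensional ℝ E] {Ω : E → E → ℝ}
    {B : E →L[ℝ] E →L[ℝ] ℝ} {J : (E →L[ℝ] ℝ) →L[ℝ] E} (hΩ : ∀ u v, Ω u v = B u v)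
    (hBJ : ∀ ℓ, B (J ℓ) = ℓ) (hJB : ∀ V, J (B V) = V)
    {U O K : Set E} (hU : IsOpen U) (hO : IsOpen O) {H : E → ℝ} (hH : ContDiffOn ℝ ∞ H O)
    (hK : IsCompact K) (hKU : K ⊆ U) (hKO : K ⊆ O) {ι : Type*} {c : ι → ℝ → E}
    (hc : ∀ x, ∀ τ ∈ Set.Icc (0 : ℝ) 1, c x τ ∈ K)
    (hflow : ∀ x, ∀ τ ∈ Set.Icc (0 : ℝ) 1, ∃ V : E, HasDerivAt (c x) V τ ∧
      ∀ w, Ω V w = fderiv ℝ H (c x τ) w) :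
    HamiltonianIsotopic Ω U (Set.range fun x => c x 0) (Set.range fun x => c x 1) := by
  obtain ⟨G, K', hG, hK', hK'W, hzero, heq⟩ :=
    exists_contDiff_cutoff (hU.inter hO) hK (Set.subset_inter hKU hKO)
      (hH.mono Set.inter_subset_right)
  set X : E → E := fun x => J (fderiv ℝ G x) with hX
  have hXsm : ContDiff ℝ ∞ X := J.contDiff.comp (hG.fderiv_right (by simp))
  have hXsupp : HasCompactSupport X := by
    refine HasCompactSupport.intro hK' fun x hx => ?_
    have : G =ᶠ[𝓝 x] fun _ => 0 := by
      filter_upwards [hK'.isClosed.isOpen_compl.mem_nhds hx] with y hy using hzero y hy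
    simp [hX, this.fderiv_eq]
  obtain ⟨L, hL⟩ := (hXsm.of_le (by simp : (1 : WithTop ℕ∞) ≤ ∞)).lipschitzWith_of_hasCompactSupport
    hXsupp (by simp)
  obtain ⟨M, hM⟩ := hXsupp.exists_bound_of_continuous hXsm.continuous
  obtain ⟨φ, hφ0, hφ⟩ := exists_global_flow (M := M.toNNReal) hL
    (fun x => (hM x).trans (Real.le_coe_toNNReal M))
  refine ⟨fun _ => G, φ, ⟨?_, ⟨K', hK', hK'W.trans Set.inter_subset_left, fun _ => hzero⟩, hφ0,
    fun t x => ⟨_, hφ t x, fun w => ?_⟩⟩, ?_⟩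
  · exact hG.comp contDiff_snd
  · simp [hΩ, hX, hBJ]
  · rw [← Set.range_comp]
    congr 1
    ext x
    have hder : ∀ τ ∈ Set.Icc (0 : ℝ) 1, HasDerivAt (c x) (X (c x τ)) τ := by
      intro τ hτ
      obtain ⟨V, hV, hVw⟩ := hflow x τ hτ
      have : B V = fderiv ℝ G (c x τ) := by
        ext w
        rw [← hΩ, hVw, (heq _ (hc x τ hτ)).fderiv_eq]
      have hVX : X (c x τ) = V := by simp only [hX]; rw [← this, hJB]
      rw [hVX]; exact hV
    have := ODE_solution_unique (v := fun _ => X) (a := 0) (b := 1) (f := fun s => φ s (c x 0))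
      (g := c x) (fun _ => hL)
      (fun t _ => (hφ t _).continuousAt.continuousWithinAt)
      (fun t _ => (hφ t _).hasDerivWithinAt)
      (fun t ht => (hder t ht).continuousAt.continuousWithinAt)
      (fun t ht => (hder t ⟨ht.1, ht.2.le⟩).hasDerivWithinAt)
      (hφ0 _)
    exact this ⟨zero_le_one, le_rfl⟩

end Isotopy

/-! ### Parametrised submanifolds -/

section Param

variable {E F : Type*} [NormedAddCommGroup E] [NormedSpace ℝ E]
  [NormedAddCommGroup F] [NormedSpace ℝ F]

/-- `f` is a smooth map with local smooth left inverses near each point of its range, defined on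
open sets of the ambient space and sending points of the range to parameters of these points.
So `f` parametrises an embedded submanifold, possibly in a many-to-one way. -/
structure IsSubmanifoldParam (f : F → E) : Prop where
  smooth : ContDiff ℝ ∞ f
  exists_inverse : ∀ x, ∃ g : E → F, (∀ᶠ p in 𝓝 (f x), ContDiffAt ℝ ∞ g p) ∧
    (∀ᶠ y in 𝓝 x, g (f y) = y) ∧ ∀ᶠ p in 𝓝 (f x), p ∈ Set.range f → f (g p) = p

theorem IsSubmanifoldParam.inverse_comp_fderiv {f : F → E} (hf : IsSubmanifoldParam f) {x : F}
    {g : E → F} (hg : ∀ᶠ p in 𝓝 (f x), ContDiffAt ℝ ∞ g p) (hgf : ∀ᶠ y in 𝓝 x, g (f y) = y)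
    (v : F) : fderiv ℝ g (f x) (fderiv ℝ f x v) = v := by
  have h1 : HasFDerivAt g (fderiv ℝ g (f x)) (f x) :=
    (hg.self_of_nhds.differentiableAt (by simp)).hasFDerivAt
  have h2 : HasFDerivAt f (fderiv ℝ f x) x :=
    (hf.smooth.differentiable (by simp) x).hasFDerivAt
  have h3 := (h1.comp x h2).congr_of_eventuallyEq (f₁ := id) (by
    filter_upwards [hgf] with y hy using hy.symm)
  have := h3.unique (hasFDerivAt_id x)
  simpa using congrArg (fun T => T v) this

/-- A straightening chart at `f x₀` is `p ↦ D (g p - x₀) + (1 - P) (p - f (g p))`, where `g` is the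
local inverse, `D` the derivative of `f` at `x₀` and `P` that of the retraction `f ∘ g`. -/
theorem IsSubmanifoldParam.isSmoothSubmanifold [FiniteDimensional ℝ E] [FiniteDimensional ℝ F]
    {f : F → E} (hf : IsSubmanifoldParam f) :
    IsSmoothSubmanifold (Module.finrank ℝ F) (Set.range f) := by
  rintro _ ⟨x₀, rfl⟩
  obtain ⟨g, hg, hgf, hfg⟩ := hf.exists_inverse x₀
  have hDD := hf.inverse_comp_fderiv hg hgf
  set D := fderiv ℝ f x₀ with hD
  set D' := fderiv ℝ g (f x₀) with hD'
  set p₀ := f x₀ with hp₀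
  have hgp : g p₀ = x₀ := hgf.self_of_nhds
  set P : E →L[ℝ] E := D.comp D' with hP
  set Q : E →L[ℝ] E := ContinuousLinearMap.id ℝ E - P with hQ
  have hQD : ∀ v, Q (D v) = 0 := fun v => by simp [hQ, hP, hDD]
  set Φ : E → E := fun p => D (g p - x₀) + Q (p - f (g p)) with hΦ
  have hΦsm : ∀ᶠ p in 𝓝 p₀, ContDiffAt ℝ ∞ Φ p := by
    filter_upwards [hg] with p hp
    exact (D.contDiff.contDiffAt.comp p (hp.sub contDiffAt_const)).add
      (Q.contDiff.contDiffAt.comp p (contDiffAt_id.sub (hf.smooth.contDiffAt.comp p hp)))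
  have hΦ' : HasFDerivAt Φ ((ContinuousLinearEquiv.refl ℝ E : E ≃L[ℝ] E) : E →L[ℝ] E) p₀ := by
    have h1 : HasFDerivAt g D' p₀ := (hg.self_of_nhds.differentiableAt (by simp)).hasFDerivAt
    have h2 : HasFDerivAt f D (g p₀) := by
      rw [hgp]; exact (hf.smooth.differentiable (by simp) x₀).hasFDerivAt
    have h3 := (D.hasFDerivAt.comp p₀ (h1.sub_const x₀)).add
      (Q.hasFDerivAt.comp p₀ ((hasFDerivAt_id p₀).sub (h2.comp p₀ h1)))
    refine h3.congr_fderiv ?_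
    ext v
    simp [hQ, hP, hDD]
  have hinv : ∀ᶠ p in 𝓝 p₀, fderiv ℝ Φ p ∈
      Set.range ((↑) : (E ≃L[ℝ] E) → E →L[ℝ] E) := by
    have hc : ContinuousAt (fderiv ℝ Φ) p₀ :=
      (hΦsm.self_of_nhds.fderiv_right (m := 0) (by simp)).continuousAt
    have hn := ContinuousLinearEquiv.nhds (ContinuousLinearEquiv.refl ℝ E)
    rw [← hΦ'.fderiv] at hn
    exact hc hn
  set e₀ := hΦsm.self_of_nhds.toOpenPartialHomeomorph Φ hΦ' (by simp) with he₀
  have he₀Φ : ∀ p, e₀ p = Φ p := fun p => rfl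
  have hp₀s : p₀ ∈ e₀.source :=
    hΦsm.self_of_nhds.mem_toOpenPartialHomeomorph_source hΦ' (by simp)
  have hgc : ContinuousAt g p₀ := hg.self_of_nhds.continuousAt
  have hgf' : ∀ᶠ p in 𝓝 p₀, g (f (g p)) = g p := by
    have : Filter.Tendsto g (𝓝 p₀) (𝓝 x₀) := by simpa [ContinuousAt, hgp] using hgc
    exact this.eventually hgf
  have hfgs : ∀ᶠ p in 𝓝 p₀, f (g p) ∈ e₀.source := by
    have : ContinuousAt (fun p => f (g p)) p₀ := hf.smooth.continuous.continuousAt.comp hgc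
    refine this.eventually (e₀.open_source.mem_nhds ?_)
    show f (g p₀) ∈ e₀.source
    rw [hgp]; exact hp₀s
  obtain ⟨N, hN, hNo, hpN⟩ := eventually_nhds_iff.1
    (hΦsm.and (hinv.and (hfg.and (hgf'.and hfgs))))
  refine ⟨e₀.restrOpen N hNo, LinearMap.range (D : F →ₗ[ℝ] E), ?_, ?_, ?_, ?_, ?_⟩
  · rw [OpenPartialHomeomorph.restrOpen_source]; exact ⟨hp₀s, hpN⟩
  · intro p hp
    rw [OpenPartialHomeomorph.restrOpen_source] at hp
    exact (hN p hp.2).1.contDiffWithinAt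
  · intro y hy
    set e := e₀.restrOpen N hNo with he
    have hs : e.symm y ∈ e.source := e.map_target hy
    rw [he, OpenPartialHomeomorph.restrOpen_source] at hs
    obtain ⟨hsm, ⟨T, hT⟩, -⟩ := hN _ hs.2
    refine (e.contDiffAt_symm (f₀' := T) hy ?_ hsm).contDiffWithinAt
    rw [hT]
    exact (hsm.differentiableAt (by simp)).hasFDerivAt
  · apply LinearMap.finrank_range_of_inj
    intro u v huv
    have : D u = D v := huv
    rw [← hDD u, this, hDD v]
  · intro q hq
    rw [OpenPartialHomeomorph.restrOpen_source] at hq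
    obtain ⟨-, -, h1, h2, h3⟩ := hN q hq.2
    change _ ↔ Φ q ∈ _
    constructor
    · intro hqS
      exact ⟨g q - x₀, by simp [hΦ, h1 hqS]⟩
    · rintro ⟨y, hy⟩
      have hy' : D y = D (g q - x₀) + Q (q - f (g q)) := hy
      have hQ0 : Q (q - f (g q)) = 0 := by
        have e1 : Q (q - f (g q)) = D (y - (g q - x₀)) := by
          have e0 : D (y - (g q - x₀)) = D y - D (g q - x₀) := map_sub _ _ _
          rw [e0, hy']; abel
        have e2 : D' (Q (q - f (g q))) = 0 := by simp [hQ, hP, hDD]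
        rw [e1, hDD] at e2
        rw [e1, e2, map_zero]
      have : e₀ q = e₀ (f (g q)) := by
        rw [he₀Φ, he₀Φ]
        simp only [hΦ, h2, hQ0, sub_self, map_zero]
      have := e₀.injOn hq.1 h3 this
      rw [this]; exact ⟨_, rfl⟩

theorem IsSubmanifoldParam.exists_eq_fderiv {f : F → E} (hf : IsSubmanifoldParam f) (x : F)
    {v : E} (hv : v ∈ tangentVectors (Set.range f) (f x)) : ∃ w, v = fderiv ℝ f x w := by
  obtain ⟨γ, hγ, h0, rfl, hS⟩ := hv
  obtain ⟨g, hg, hgf, hfg⟩ := hf.exists_inverse x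
  rw [← h0] at hg hfg
  have hγ' : HasDerivAt γ (deriv γ 0) 0 := (hγ.differentiable (by simp) 0).hasDerivAt
  have h1 : HasFDerivAt g (fderiv ℝ g (γ 0)) (γ 0) :=
    (hg.self_of_nhds.differentiableAt (by simp)).hasFDerivAt
  have hx : g (γ 0) = x := by rw [h0]; exact hgf.self_of_nhds
  have h2 : HasFDerivAt f (fderiv ℝ f x) (g (γ 0)) := by
    rw [hx]; exact (hf.smooth.differentiable (by simp) x).hasFDerivAt
  have h3 := h2.comp_hasDerivAt (0 : ℝ) (h1.comp_hasDerivAt (0 : ℝ) hγ')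
  refine ⟨_, (hγ'.unique (h3.congr_of_eventuallyEq ?_))⟩
  have hc : Filter.Tendsto γ (𝓝 0) (𝓝 (γ 0)) := hγ.continuous.continuousAt
  filter_upwards [hS, hc.eventually hfg] with t ht1 ht2
  exact (ht2 ht1).symm

theorem two_le_infty : (2 : WithTop ℕ∞) ≤ ∞ := by
  exact ENat.LEInfty.out

theorem hasFDerivAt_bilinear_fderiv (B : E →L[ℝ] E →L[ℝ] ℝ) {f : F → E} (hf : ContDiff ℝ ∞ f)
    (x v : F) : ∃ T : F →L[ℝ] ℝ, HasFDerivAt (fun y => B (f y) (fderiv ℝ f y v)) T x ∧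
      ∀ u, T u = B (f x) (fderiv ℝ (fderiv ℝ f) x u v)
        + B (fderiv ℝ f x u) (fderiv ℝ f x v) := by
  have hf1 : HasFDerivAt f (fderiv ℝ f x) x := (hf.differentiable (by simp) x).hasFDerivAt
  have hf2 : HasFDerivAt (fderiv ℝ f) (fderiv ℝ (fderiv ℝ f) x) x :=
    (((hf.fderiv_right (m := ∞) (by simp)).differentiable (by simp)) x).hasFDerivAt
  exact ⟨_, B.hasFDerivAt_of_bilinear hf1 (hf2.clm_apply (hasFDerivAt_const v x)),
    fun u => by simp⟩

/-- If the pullback of the primitive `½ Ω(x, dx)` of a constant symplectic form is the differential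
of a function, then the pullback of the form vanishes. -/
theorem eq_zero_of_primitive_exact {B : E →L[ℝ] E →L[ℝ] ℝ} (hB : ∀ u v, B u v = -B v u)
    {f : F → E} (hf : ContDiff ℝ ∞ f) {κ : F → ℝ} (hκ : ContDiff ℝ ∞ κ)
    (h : ∀ x v, 1 / 2 * B (f x) (fderiv ℝ f x v) = fderiv ℝ κ x v) (x u v : F) :
    B (fderiv ℝ f x u) (fderiv ℝ f x v) = 0 := by
  have hκ2 : HasFDerivAt (fderiv ℝ κ) (fderiv ℝ (fderiv ℝ κ) x) x :=
    (((hκ.fderiv_right (m := ∞) (by simp)).differentiable (by simp)) x).hasFDerivAt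
  have key : ∀ u v, B (f x) (fderiv ℝ (fderiv ℝ f) x u v) + B (fderiv ℝ f x u) (fderiv ℝ f x v)
      = 2 * fderiv ℝ (fderiv ℝ κ) x u v := by
    intro u v
    obtain ⟨T, h1, hT⟩ := hasFDerivAt_bilinear_fderiv B hf x v
    have h2 := (hκ2.clm_apply (hasFDerivAt_const v x)).const_mul 2
    have h3 : (fun y => B (f y) (fderiv ℝ f y v)) = fun y => 2 * fderiv ℝ κ y v := by
      ext y; rw [← h]; ring
    rw [h3] at h1
    have := congrArg (fun T => T u) (h1.unique h2)
    simpa [hT] using this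
  have s1 : fderiv ℝ (fderiv ℝ f) x u v = fderiv ℝ (fderiv ℝ f) x v u :=
    (hf.contDiffAt.isSymmSndFDerivAt (by simpa using two_le_infty)) u v
  have s2 : fderiv ℝ (fderiv ℝ κ) x u v = fderiv ℝ (fderiv ℝ κ) x v u :=
    (hκ.contDiffAt.isSymmSndFDerivAt (by simpa using two_le_infty)) u v
  have k1 := key u v
  have k2 := key v u
  rw [← s1, ← s2, hB (fderiv ℝ f x v)] at k2
  linarith

end Param

/-! ### Stokes' theorem for smooth triangles -/

open MeasureTheory

theorem stdTriangle_isCompact : IsCompact stdTriangle := by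
  refine (isCompact_Icc (a := ((0 : ℝ), (0 : ℝ))) (b := (1, 1))).of_isClosed_subset ?_ ?_
  · have h1 : IsClosed {p : ℝ × ℝ | 0 ≤ p.1} := isClosed_le continuous_const continuous_fst
    have h2 : IsClosed {p : ℝ × ℝ | 0 ≤ p.2} := isClosed_le continuous_const continuous_snd
    have h3 : IsClosed {p : ℝ × ℝ | p.1 + p.2 ≤ 1} :=
      isClosed_le (continuous_fst.add continuous_snd) continuous_const
    have : stdTriangle = {p : ℝ × ℝ | 0 ≤ p.1} ∩ ({p : ℝ × ℝ | 0 ≤ p.2} ∩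
        {p : ℝ × ℝ | p.1 + p.2 ≤ 1}) := by
      ext p; simp [stdTriangle]
    rw [this]
    exact h1.inter (h2.inter h3)
  · rintro ⟨x, y⟩ ⟨h1, h2, h3⟩
    simp only at h1 h2 h3
    exact ⟨⟨h1, h2⟩, ⟨by simp only; linarith, by simp only; linarith⟩⟩

theorem integrable_indicator_stdTriangle {f : ℝ × ℝ → ℝ} (hf : Continuous f) :
    Integrable (stdTriangle.indicator f) :=
  (hf.continuousOn.integrableOn_compact stdTriangle_isCompact).integrable_indicator
    stdTriangle_isCompact.measurableSet

theorem integral_stdTriangle {f : ℝ × ℝ → ℝ} (hf : Continuous f) :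
    ∫ p in stdTriangle, f p = ∫ x in (0 : ℝ)..1, ∫ y in (0 : ℝ)..(1 - x), f (x, y) := by
  rw [← integral_indicator stdTriangle_isCompact.measurableSet, Measure.volume_eq_prod,
    integral_prod _ (integrable_indicator_stdTriangle hf),
    intervalIntegral.integral_of_le zero_le_one, ← integral_Icc_eq_integral_Ioc,
    ← integral_indicator measurableSet_Icc]
  congr 1
  ext x
  by_cases hx : x ∈ Set.Icc (0 : ℝ) 1
  · rw [Set.indicator_of_mem hx, intervalIntegral.integral_of_le (by linarith [hx.2]),
      ← integral_Icc_eq_integral_Ioc, ← integral_indicator measurableSet_Icc]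
    congr 1
    ext y
    have : (x, y) ∈ stdTriangle ↔ y ∈ Set.Icc 0 (1 - x) :=
      ⟨fun h => ⟨h.2.1, by linarith [show x + y ≤ 1 from h.2.2]⟩,
        fun h => ⟨hx.1, h.1, by show x + y ≤ 1; linarith [h.2]⟩⟩
    simp only [Set.indicator, this]
  · rw [Set.indicator_of_notMem hx]
    have : ∀ y, stdTriangle.indicator f (x, y) = 0 := by
      intro y
      refine Set.indicator_of_notMem (fun h => hx ⟨h.1, ?_⟩) _
      have h1 : 0 ≤ y := h.2.1
      have h2 : x + y ≤ 1 := h.2.2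
      linarith
    simp [this]

theorem integral_stdTriangle_symm {f : ℝ × ℝ → ℝ} (hf : Continuous f) :
    ∫ p in stdTriangle, f p = ∫ y in (0 : ℝ)..1, ∫ x in (0 : ℝ)..(1 - y), f (x, y) := by
  have h := integral_stdTriangle (f := fun p => f p.swap) (hf.comp continuous_swap)
  simp only [Prod.swap_prod_mk] at h
  rw [← h,
    ← integral_indicator stdTriangle_isCompact.measurableSet,
    ← integral_indicator stdTriangle_isCompact.measurableSet, Measure.volume_eq_prod,
    ← integral_prod_swap]
  congr 1
  ext p
  have : p.swap ∈ stdTriangle ↔ p ∈ stdTriangle := by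
    simp only [stdTriangle, Set.mem_ofPred_eq, Prod.fst_swap, Prod.snd_swap, add_comm p.2]
    tauto
  by_cases hp : p ∈ stdTriangle
  · simp [hp, this.2 hp]
  · simp [hp, mt this.1 hp]

/-- Green's theorem on the standard triangle. -/
theorem integral_stdTriangle_green {P R Py Rx : ℝ × ℝ → ℝ} (hP : Continuous P) (hR : Continuous R)
    (hPy : Continuous Py) (hRx : Continuous Rx)
    (hP' : ∀ x y, HasDerivAt (fun y => P (x, y)) (Py (x, y)) y)
    (hR' : ∀ x y, HasDerivAt (fun x => R (x, y)) (Rx (x, y)) x) :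
    ∫ p in stdTriangle, (Rx p - Py p) =
      (∫ t in (0 : ℝ)..1, (R (1 - t, t) - P (1 - t, t))) - (∫ t in (0 : ℝ)..1, R (0, t))
        + ∫ t in (0 : ℝ)..1, P (t, 0) := by
  have hint : ∀ {f : ℝ × ℝ → ℝ}, Continuous f → IntegrableOn f stdTriangle := fun hf =>
    hf.continuousOn.integrableOn_compact stdTriangle_isCompact
  rw [integral_sub (hint hRx) (hint hPy), integral_stdTriangle hPy, integral_stdTriangle_symm hRx]
  have e1 : ∀ y : ℝ, ∫ x in (0 : ℝ)..(1 - y), Rx (x, y) = R (1 - y, y) - R (0, y) := fun y =>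
    intervalIntegral.integral_eq_sub_of_hasDerivAt (fun x _ => hR' x y)
      ((hRx.comp (by fun_prop)).intervalIntegrable _ _)
  have e2 : ∀ x : ℝ, ∫ y in (0 : ℝ)..(1 - x), Py (x, y) = P (x, 1 - x) - P (x, 0) := fun x =>
    intervalIntegral.integral_eq_sub_of_hasDerivAt (fun y _ => hP' x y)
      ((hPy.comp (by fun_prop)).intervalIntegrable _ _)
  have i1 : IntervalIntegrable (fun t : ℝ => R (1 - t, t)) volume 0 1 :=
    (hR.comp (by fun_prop)).intervalIntegrable _ _
  have i2 : IntervalIntegrable (fun t : ℝ => P (1 - t, t)) volume 0 1 :=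
    (hP.comp (by fun_prop)).intervalIntegrable _ _
  have i3 : IntervalIntegrable (fun t : ℝ => R (0, t)) volume 0 1 :=
    (hR.comp (by fun_prop)).intervalIntegrable _ _
  have i4 : IntervalIntegrable (fun t : ℝ => P (t, 1 - t)) volume 0 1 :=
    (hP.comp (by fun_prop)).intervalIntegrable _ _
  have i5 : IntervalIntegrable (fun t : ℝ => P (t, 0)) volume 0 1 :=
    (hP.comp (by fun_prop)).intervalIntegrable _ _
  simp only [e1, e2]
  rw [intervalIntegral.integral_sub i1 i3, intervalIntegral.integral_sub i4 i5,
    intervalIntegral.integral_sub i1 i2]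
  have e3 : ∫ t in (0 : ℝ)..1, P (1 - t, t) = ∫ t in (0 : ℝ)..1, P (t, 1 - t) := by
    have := intervalIntegral.integral_comp_sub_left (a := 0) (b := 1)
      (fun t : ℝ => P (t, 1 - t)) 1
    simpa using this
  rw [e3]; ring

section Stokes

variable {E : Type*} [NormedAddCommGroup E] [NormedSpace ℝ E]

/-- The integral of the primitive `½ B(x, dx)` of the constant form `B` over a path. -/
noncomputable def pathAction (B : E →L[ℝ] E →L[ℝ] ℝ) (γ : unitInterval → E) : ℝ :=
  ∫ t in (0 : ℝ)..1, 1 / 2 * B (Set.IccExtend zero_le_one γ t)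
    (deriv (Set.IccExtend zero_le_one γ) t)

theorem pathAction_eq (B : E →L[ℝ] E →L[ℝ] ℝ) {γ : unitInterval → E} {g : ℝ → E}
    (h : ∀ t : unitInterval, γ t = g t) :
    pathAction B γ = ∫ t in (0 : ℝ)..1, 1 / 2 * B (g t) (deriv g t) := by
  refine intervalIntegral.integral_congr_Ioo_of_le zero_le_one fun t ht => ?_
  have heq : ∀ s ∈ Set.Ioo (0 : ℝ) 1, Set.IccExtend zero_le_one γ s = g s := by
    intro s hs
    rw [Set.IccExtend_of_mem _ _ (Set.Ioo_subset_Icc_self hs), h]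
  have hev : Set.IccExtend zero_le_one γ =ᶠ[𝓝 t] g := by
    filter_upwards [Ioo_mem_nhds ht.1 ht.2] with s hs using heq s hs
  simp only [heq t ht, hev.deriv_eq]

theorem SmoothTriangle.area_eq_pathAction {Ω : E → E → ℝ} {B : E →L[ℝ] E →L[ℝ] ℝ}
    (hΩ : ∀ u v, Ω u v = B u v) (hB : ∀ u v, B u v = -B v u) {U : Set E} (σ : SmoothTriangle U) :
    σ.area Ω = pathAction B σ.face₀ - pathAction B σ.face₁ + pathAction B σ.face₂ := by
  set f := σ.toFun with hf
  have sm : ContDiff ℝ ∞ f := σ.smooth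
  have sm1 : ContDiff ℝ ∞ (fderiv ℝ f) := sm.fderiv_right (by simp)
  have hd : ∀ p, HasFDerivAt f (fderiv ℝ f p) p := fun p =>
    (sm.differentiable (by simp) p).hasFDerivAt
  have c0 := sm.continuous
  have c1 := sm1.continuous
  have c2 : Continuous (fderiv ℝ (fderiv ℝ f)) := (sm1.fderiv_right (m := 0) (by simp)).continuous
  set X : ℝ × ℝ := (1, 0)
  set Y : ℝ × ℝ := (0, 1)
  have hX : ∀ x y, HasDerivAt (fun x : ℝ => ((x, y) : ℝ × ℝ)) X x := fun x y =>
    (hasDerivAt_id x).prodMk (hasDerivAt_const x y)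
  have hY : ∀ x y, HasDerivAt (fun y : ℝ => ((x, y) : ℝ × ℝ)) Y y := fun x y =>
    (hasDerivAt_const y x).prodMk (hasDerivAt_id y)
  have green := integral_stdTriangle_green
    (P := fun p => 1 / 2 * B (f p) (fderiv ℝ f p X))
    (R := fun p => 1 / 2 * B (f p) (fderiv ℝ f p Y))
    (Py := fun p => 1 / 2 * (B (f p) (fderiv ℝ (fderiv ℝ f) p Y X)
      + B (fderiv ℝ f p Y) (fderiv ℝ f p X)))
    (Rx := fun p => 1 / 2 * (B (f p) (fderiv ℝ (fderiv ℝ f) p X Y)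
      + B (fderiv ℝ f p X) (fderiv ℝ f p Y)))
    (by fun_prop) (by fun_prop) (by fun_prop) (by fun_prop) ?_ ?_
  · have e1 : σ.area Ω = ∫ p in stdTriangle, Ω (fderiv ℝ f p X) (fderiv ℝ f p Y) := rfl
    rw [e1, pathAction_eq B (γ := σ.face₀) (g := fun t => f (1 - t, t)) (fun _ => rfl),
      pathAction_eq B (γ := σ.face₁) (g := fun t => f (0, t)) (fun _ => rfl),
      pathAction_eq B (γ := σ.face₂) (g := fun t => f (t, 0)) (fun _ => rfl)]
    have d0 : ∀ t : ℝ, deriv (fun t : ℝ => f (1 - t, t)) t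
        = fderiv ℝ f (1 - t, t) Y - fderiv ℝ f (1 - t, t) X := by
      intro t
      have h1 : HasDerivAt (fun t : ℝ => ((1 - t, t) : ℝ × ℝ)) (Y - X) t := by
        have := ((hasDerivAt_id t).const_sub 1).prodMk (hasDerivAt_id t)
        simpa [X, Y] using this
      rw [← map_sub]
      exact ((hd _).comp_hasDerivAt t h1).deriv
    have d1 : ∀ t : ℝ, deriv (fun t : ℝ => f (0, t)) t = fderiv ℝ f (0, t) Y := fun t =>
      ((hd _).comp_hasDerivAt t (hY 0 t)).deriv
    have d2 : ∀ t : ℝ, deriv (fun t : ℝ => f (t, 0)) t = fderiv ℝ f (t, 0) X := fun t =>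
      ((hd _).comp_hasDerivAt t (hX t 0)).deriv
    simp only [d0, d1, d2, map_sub, mul_sub]
    rw [← green]
    refine integral_congr_ae (Filter.Eventually.of_forall fun p => ?_)
    have s1 : fderiv ℝ (fderiv ℝ f) p X Y = fderiv ℝ (fderiv ℝ f) p Y X :=
      (sm.contDiffAt.isSymmSndFDerivAt (by simpa using two_le_infty)) X Y
    simp only [hΩ, s1]
    rw [hB (fderiv ℝ f p Y)]
    ring
  · intro x y
    obtain ⟨T, h1, hT⟩ := hasFDerivAt_bilinear_fderiv B sm (x, y) X
    rw [← hT]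
    exact (h1.comp_hasDerivAt y (hY x y)).const_mul (1 / 2)
  · intro x y
    obtain ⟨T, h1, hT⟩ := hasFDerivAt_bilinear_fderiv B sm (x, y) Y
    rw [← hT]
    exact (h1.comp_hasDerivAt x (hX x y)).const_mul (1 / 2)

end Stokes

/-- The extension of a real-valued function on paths to chains of paths. -/
noncomputable def chainEval {E : Type*} (a : (unitInterval → E) → ℝ) :
    ((unitInterval → E) →₀ ℤ) →+ ℝ :=
  Finsupp.liftAddHom fun γ => (AddMonoidHom.mulRight (a γ)).comp (Int.castAddHom ℝ)

theorem chainEval_single {E : Type*} (a : (unitInterval → E) → ℝ) (γ : unitInterval → E)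
    (n : ℤ) :
    chainEval a (Finsupp.single γ n) = n * a γ := by
  simp [chainEval]

section IntegralAreas

variable {E F : Type*} [NormedAddCommGroup E] [NormedSpace ℝ E]
  [NormedAddCommGroup F] [NormedSpace ℝ F]

/-- Along a path in the submanifold, `exp (2πi (κ - ∫ ½ B(x, dx)))` is locally constant. Here `G`
is a choice of values of `κ`, which is only defined modulo integers on the submanifold. -/
theorem exists_int_pathAction {B : E →L[ℝ] E →L[ℝ] ℝ} {f : F → E} (hf : IsSubmanifoldParam f)
    {κ : F → ℝ} (hκ : ContDiff ℝ ∞ κ)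
    (h : ∀ x v, 1 / 2 * B (f x) (fderiv ℝ f x v) = fderiv ℝ κ x v)
    {G : E → ℝ} (hG : ∀ x, ∃ n : ℤ, G (f x) = κ x + n) {γ : ℝ → E} (hγ : ContDiff ℝ ∞ γ)
    (hS : ∀ t ∈ Set.Icc (0 : ℝ) 1, γ t ∈ Set.range f) :
    ∃ n : ℤ, ∫ t in (0 : ℝ)..1, 1 / 2 * B (γ t) (deriv γ t) = G (γ 1) - G (γ 0) + n := by
  have hγd : ∀ t, HasDerivAt γ (deriv γ t) t := fun t =>
    (hγ.differentiable (by simp) t).hasDerivAt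
  have hint : Continuous fun t => 1 / 2 * B (γ t) (deriv γ t) := by
    have c1 := hγ.continuous
    have c2 : Continuous (deriv γ) := (contDiff_infty_iff_deriv.1 hγ).2.continuous
    fun_prop
  set θ : ℝ → ℝ := fun τ => ∫ t in (0 : ℝ)..τ, 1 / 2 * B (γ t) (deriv γ t) with hθ
  have hθd : ∀ τ, HasDerivAt θ (1 / 2 * B (γ τ) (deriv γ τ)) τ := fun τ =>
    intervalIntegral.integral_hasDerivAt_right (hint.intervalIntegrable _ _)
      (hint.stronglyMeasurableAtFilter _ _) hint.continuousAt
  set Q : ℝ → ℂ := fun τ => Complex.exp (2 * Real.pi * Complex.I * ((G (γ τ) - θ τ : ℝ) : ℂ))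
    with hQ
  have hQd : ∀ τ ∈ Set.Icc (0 : ℝ) 1, HasDerivWithinAt Q 0 (Set.Icc 0 1) τ := by
    intro τ hτ
    obtain ⟨x, hx⟩ := hS τ hτ
    obtain ⟨g, hg, hgf, hfg⟩ := hf.exists_inverse x
    have hgx : g (γ τ) = x := by rw [← hx]; exact hgf.self_of_nhds
    rw [hx] at hg hfg
    have hcγ : Filter.Tendsto γ (𝓝[Set.Icc 0 1] τ) (𝓝 (γ τ)) :=
      hγ.continuous.continuousWithinAt
    have hev : ∀ᶠ t in 𝓝[Set.Icc 0 1] τ, f (g (γ t)) = γ t := by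
      filter_upwards [hcγ.eventually hfg, self_mem_nhdsWithin] with t h1 h2 using h1 (hS t h2)
    have hg' : HasFDerivAt g (fderiv ℝ g (γ τ)) (γ τ) :=
      (hg.self_of_nhds.differentiableAt (by simp)).hasFDerivAt
    have hy : HasDerivAt (fun t => g (γ t)) (fderiv ℝ g (γ τ) (deriv γ τ)) τ :=
      hg'.comp_hasDerivAt τ (hγd τ)
    set w := fderiv ℝ g (γ τ) (deriv γ τ)
    have hf' : HasFDerivAt f (fderiv ℝ f x) (g (γ τ)) := by
      rw [hgx]; exact (hf.smooth.differentiable (by simp) x).hasFDerivAt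
    have hκ' : HasFDerivAt κ (fderiv ℝ κ x) (g (γ τ)) := by
      rw [hgx]; exact (hκ.differentiable (by simp) x).hasFDerivAt
    have hfy : HasDerivAt (fun t => f (g (γ t))) (fderiv ℝ f x w) τ := hf'.comp_hasDerivAt τ hy
    have hder : deriv γ τ = fderiv ℝ f x w :=
      (uniqueDiffOn_Icc zero_lt_one τ hτ).eq_deriv _ (hγd τ).hasDerivWithinAt
        (hfy.hasDerivWithinAt.congr_of_eventuallyEq (hev.mono fun t ht => ht.symm)
          (hev.self_of_nhdsWithin hτ).symm)
    have hκy : HasDerivAt (fun t => κ (g (γ t)) - θ t) 0 τ := by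
      refine ((hκ'.comp_hasDerivAt τ hy).sub (hθd τ)).congr_deriv ?_
      rw [hder, ← hx, h, sub_self]
    have hexp : HasDerivAt (fun t => Complex.exp (2 * Real.pi * Complex.I *
        ((κ (g (γ t)) - θ t : ℝ) : ℂ))) 0 τ := by
      simpa using (hκy.ofReal_comp.const_mul (2 * Real.pi * Complex.I)).cexp
    have hEq : ∀ t, f (g (γ t)) = γ t → Q t = Complex.exp (2 * Real.pi * Complex.I *
        ((κ (g (γ t)) - θ t : ℝ) : ℂ)) := by
      intro t ht
      obtain ⟨n, hn⟩ := hG (g (γ t))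
      rw [ht] at hn
      rw [hQ, Complex.exp_eq_exp_iff_exists_int]
      refine ⟨n, ?_⟩
      rw [hn]; push_cast; ring
    exact hexp.hasDerivWithinAt.congr_of_eventuallyEq (hev.mono hEq)
      (hEq τ (hev.self_of_nhdsWithin hτ))
  have hconst := constant_of_derivWithin_zero (a := 0) (b := 1)
    (fun τ hτ => (hQd τ hτ).differentiableWithinAt)
    (fun τ hτ => (hQd τ ⟨hτ.1, hτ.2.le⟩).derivWithin
      (uniqueDiffOn_Icc zero_lt_one τ ⟨hτ.1, hτ.2.le⟩)) 1 ⟨zero_le_one, le_rfl⟩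
  simp only [hQ] at hconst
  rw [Complex.exp_eq_exp_iff_exists_int] at hconst
  obtain ⟨n, hn⟩ := hconst
  have hθ0 : θ 0 = 0 := by simp [hθ]
  rw [hθ0] at hn
  refine ⟨-n, ?_⟩
  change θ 1 = _
  have h2 : (2 * Real.pi * Complex.I : ℂ) ≠ 0 := by
    simp [Real.pi_ne_zero]
  have h3 : ((G (γ 1) - θ 1 : ℝ) : ℂ) = ((G (γ 0) - 0 + n : ℝ) : ℂ) := by
    apply mul_left_cancel₀ h2
    rw [hn]; push_cast; ring
  have h4 := Complex.ofReal_injective h3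
  push_cast
  linarith

theorem chainEval_chainBoundary (a : (unitInterval → E) → ℝ) {U : Set E}
    (c : SmoothTriangle U →₀ ℤ) : chainEval a (chainBoundary c)
      = c.sum fun σ n => (n : ℝ) * (a σ.face₀ - a σ.face₁ + a σ.face₂) := by
  rw [chainBoundary, map_finsuppSum]
  refine Finsupp.sum_congr fun σ _ => ?_
  rw [map_add, map_sub, chainEval_single, chainEval_single, chainEval_single]
  ring

/-- A path occurring in the boundary of a smooth chain has a smooth extension to the line. -/
theorem exists_smooth_of_mem_support_chainBoundary {U : Set E} {c : SmoothTriangle U →₀ ℤ}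
    {γ : unitInterval → E} (hγ : γ ∈ (chainBoundary c).support) :
    ∃ g : ℝ → E, ContDiff ℝ ∞ g ∧ ∀ t : unitInterval, γ t = g t := by
  by_contra hno
  have key : ∀ (σ : SmoothTriangle U) {g : ℝ → ℝ × ℝ}, ContDiff ℝ ∞ g →
      (fun t : unitInterval => σ.toFun (g t)) ≠ γ := by
    intro σ g hg heq
    exact hno ⟨fun t => σ.toFun (g t), σ.smooth.comp hg, fun t => by rw [← heq]⟩
  refine Finsupp.mem_support_iff.1 hγ ?_
  rw [chainBoundary, Finsupp.sum_apply]
  refine Finset.sum_eq_zero fun σ _ => ?_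
  have h0 : σ.face₀ ≠ γ := key σ (g := fun t => (1 - t, t)) (by fun_prop)
  have h1 : σ.face₁ ≠ γ := key σ (g := fun t => (0, t)) (by fun_prop)
  have h2 : σ.face₂ ≠ γ := key σ (g := fun t => (t, 0)) (by fun_prop)
  simp [h0, h1, h2]

/-- By Stokes' theorem the area of a relative cycle is the integral of the primitive `½ B(x, dx)`
over its boundary. Modulo integers that integral is a difference of end point values for each
path in the boundary, and these cancel because the boundary is closed. -/
theorem hasIntegralAreas_of_primitive {Ω : E → E → ℝ} {B : E →L[ℝ] E →L[ℝ] ℝ}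
    (hΩ : ∀ u v, Ω u v = B u v) (hB : ∀ u v, B u v = -B v u) {f : F → E}
    (hf : IsSubmanifoldParam f) {κ : F → ℝ} (hκ : ContDiff ℝ ∞ κ)
    (h : ∀ x v, 1 / 2 * B (f x) (fderiv ℝ f x v) = fderiv ℝ κ x v)
    (hper : ∀ x y, f x = f y → ∃ n : ℤ, κ x = κ y + n) (U : Set E) :
    HasIntegralAreas Ω U (Set.range f) := by
  classical
  intro c hc
  set G : E → ℝ := fun p => if hp : p ∈ Set.range f then κ hp.choose else 0 with hG
  have hG' : ∀ x, ∃ n : ℤ, G (f x) = κ x + n := by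
    intro x
    have hp : f x ∈ Set.range f := ⟨x, rfl⟩
    simp only [hG, dif_pos hp]
    exact hper _ _ hp.choose_spec
  set e : (unitInterval → E) → ℝ := fun γ => G (γ 1) - G (γ 0) with he
  have h1 : chainArea Ω c = chainEval (pathAction B) (chainBoundary c) := by
    rw [chainEval_chainBoundary, chainArea]
    exact Finsupp.sum_congr fun σ _ => by rw [σ.area_eq_pathAction hΩ hB]
  have h2 : chainEval e (chainBoundary c) = 0 := by
    rw [chainEval_chainBoundary]
    refine Finset.sum_eq_zero fun σ _ => ?_
    simp [he, SmoothTriangle.face₀, SmoothTriangle.face₁, SmoothTriangle.face₂]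
  have h3 : ∀ γ ∈ (chainBoundary c).support, ∃ n : ℤ, pathAction B γ = e γ + n := by
    intro γ hγ
    obtain ⟨g, hg, hgγ⟩ := exists_smooth_of_mem_support_chainBoundary hγ
    rw [pathAction_eq B hgγ]
    obtain ⟨n, hn⟩ := exists_int_pathAction hf hκ h hG' hg
      (fun t ht => by rw [← hgγ ⟨t, ht⟩]; exact hc γ hγ _)
    refine ⟨n, ?_⟩
    rw [hn, he]
    simp [hgγ]
  choose! n hn using h3
  refine ⟨∑ γ ∈ (chainBoundary c).support, chainBoundary c γ * n γ, ?_⟩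
  have h4 : ∀ a, chainEval a (chainBoundary c)
      = ∑ γ ∈ (chainBoundary c).support, (chainBoundary c γ : ℝ) * a γ := by
    intro a
    simp [chainEval, Finsupp.sum]
  rw [h1, ← sub_zero (chainEval _ _), ← h2, h4, h4, ← Finset.sum_sub_distrib]
  push_cast
  refine Finset.sum_congr rfl fun γ hγ => ?_
  rw [hn γ hγ]; ring

end IntegralAreas

/-! ### Symplectic polar coordinates -/

/-- `areaForm` as a continuous bilinear form. -/
noncomputable def areaFormL : ℂ →L[ℝ] ℂ →L[ℝ] ℝ :=
  Complex.reCLM.smulRight Complex.imCLM - Complex.imCLM.smulRight Complex.reCLM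

theorem areaFormL_apply (u v : ℂ) : areaFormL u v = areaForm u v := by
  simp [areaFormL, areaForm]

theorem areaForm_swap (u v : ℂ) : areaForm u v = -areaForm v u := by
  simp only [areaForm]; ring

/-- The inverse of `u ↦ areaForm u ·`. -/
noncomputable def areaDual : (ℂ →L[ℝ] ℝ) →L[ℝ] ℂ :=
  (ContinuousLinearMap.apply ℝ ℝ Complex.I).smulRight (1 : ℂ) -
    (ContinuousLinearMap.apply ℝ ℝ (1 : ℂ)).smulRight Complex.I

theorem areaFormL_areaDual (ℓ : ℂ →L[ℝ] ℝ) : areaFormL (areaDual ℓ) = ℓ := by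
  ext w
  have hw : ℓ w = w.re * ℓ 1 + w.im * ℓ Complex.I := by
    have : w = w.re • (1 : ℂ) + w.im • Complex.I := by apply Complex.ext <;> simp
    conv_lhs => rw [this]
    rw [map_add, map_smul, map_smul, smul_eq_mul, smul_eq_mul]
  rw [hw]
  simp [areaFormL_apply, areaForm, areaDual]
  ring

theorem areaDual_areaFormL (V : ℂ) : areaDual (areaFormL V) = V := by
  apply Complex.ext <;> simp [areaFormL_apply, areaForm, areaDual]

/-- `symplForm` as a continuous bilinear form. -/
noncomputable def symplFormL : ℂ × ℂ →L[ℝ] ℂ × ℂ →L[ℝ] ℝ :=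
  areaFormL.bilinearComp (.fst ℝ ℂ ℂ) (.fst ℝ ℂ ℂ) +
    areaFormL.bilinearComp (.snd ℝ ℂ ℂ) (.snd ℝ ℂ ℂ)

theorem symplFormL_apply (u v : ℂ × ℂ) : symplFormL u v = symplForm u v := by
  simp [symplFormL, symplForm, areaFormL_apply]

theorem symplFormL_swap (u v : ℂ × ℂ) : symplFormL u v = -symplFormL v u := by
  rw [symplFormL_apply, symplFormL_apply, symplForm, symplForm, areaForm_swap u.1,
    areaForm_swap u.2]
  ring

/-- The inverse of `u ↦ symplForm u ·`. -/
noncomputable def symplDual : (ℂ × ℂ →L[ℝ] ℝ) →L[ℝ] ℂ × ℂ :=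
  (areaDual.comp ((ContinuousLinearMap.compL ℝ ℂ (ℂ × ℂ) ℝ).flip (.inl ℝ ℂ ℂ))).prod
    (areaDual.comp ((ContinuousLinearMap.compL ℝ ℂ (ℂ × ℂ) ℝ).flip (.inr ℝ ℂ ℂ)))

theorem symplFormL_symplDual (ℓ : ℂ × ℂ →L[ℝ] ℝ) : symplFormL (symplDual ℓ) = ℓ := by
  have h0 : ℓ (0, 0) = 0 := map_zero ℓ
  ext w <;> simp [symplFormL, symplDual, areaFormL_areaDual, h0]

theorem symplDual_symplFormL (V : ℂ × ℂ) : symplDual (symplFormL V) = V := by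
  have h1 : (symplFormL V).comp (.inl ℝ ℂ ℂ) = areaFormL V.1 := by ext; simp [symplFormL]
  have h2 : (symplFormL V).comp (.inr ℝ ℂ ℂ) = areaFormL V.2 := by ext; simp [symplFormL]
  ext1 <;> simp [symplDual, h1, h2, areaDual_areaFormL]

/-- The point in direction `u` (a unit vector) on the circle bounding a disk of area `m`. -/
noncomputable def polarPt (m : ℝ) (u : ℂ) : ℂ := (Real.sqrt (m / Real.pi) : ℝ) * u

/-- The direction `z / ‖z‖` of a nonzero complex number. -/
noncomputable def dir (z : ℂ) : ℂ := z / (‖z‖ : ℝ)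

theorem norm_polarPt {m : ℝ} {u : ℂ} (hu : ‖u‖ = 1) : ‖polarPt m u‖ = Real.sqrt (m / Real.pi) := by
  rw [polarPt, norm_mul, hu, mul_one, Complex.norm_real, Real.norm_of_nonneg (Real.sqrt_nonneg _)]

theorem area_polarPt {m : ℝ} (hm : 0 ≤ m) {u : ℂ} (hu : ‖u‖ = 1) :
    Real.pi * ‖polarPt m u‖ ^ 2 = m := by
  rw [norm_polarPt hu, Real.sq_sqrt (by positivity)]
  field_simp

theorem sqrt_div_pi_pos {m : ℝ} (hm : 0 < m) : 0 < Real.sqrt (m / Real.pi) :=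
  Real.sqrt_pos.2 (by positivity)

theorem polarPt_ne_zero {m : ℝ} (hm : 0 < m) {u : ℂ} (hu : ‖u‖ = 1) : polarPt m u ≠ 0 := by
  rw [← norm_ne_zero_iff, norm_polarPt hu]
  exact (sqrt_div_pi_pos hm).ne'

theorem norm_dir {z : ℂ} (hz : z ≠ 0) : ‖dir z‖ = 1 := by
  rw [dir, norm_div, Complex.norm_real, norm_norm, div_self (norm_ne_zero_iff.2 hz)]

theorem dir_polarPt {m : ℝ} (hm : 0 < m) {u : ℂ} (hu : ‖u‖ = 1) : dir (polarPt m u) = u := by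
  have h := sqrt_div_pi_pos hm
  rw [dir, norm_polarPt hu, polarPt, mul_div_assoc, mul_div_cancel₀]
  exact_mod_cast h.ne'

theorem dir_mul_norm {z : ℂ} (hz : z ≠ 0) : (‖z‖ : ℂ) * dir z = z := by
  have : (‖z‖ : ℂ) ≠ 0 := by exact_mod_cast norm_ne_zero_iff.2 hz
  rw [dir]; field_simp

theorem polarPt_area_dir {z : ℂ} (hz : z ≠ 0) : polarPt (Real.pi * ‖z‖ ^ 2) (dir z) = z := by
  have : Real.sqrt (Real.pi * ‖z‖ ^ 2 / Real.pi) = ‖z‖ := by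
    rw [mul_div_cancel_left₀ _ Real.pi_ne_zero, Real.sqrt_sq (norm_nonneg z)]
  rw [polarPt, this, dir_mul_norm hz]

theorem arg_polarPt {m : ℝ} (hm : 0 < m) (u : ℂ) : Complex.arg (polarPt m u) = Complex.arg u :=
  Complex.arg_real_mul u (sqrt_div_pi_pos hm)

theorem arg_dir {z : ℂ} (hz : z ≠ 0) : Complex.arg (dir z) = Complex.arg z := by
  conv_rhs => rw [← dir_mul_norm hz]
  exact (Complex.arg_real_mul (dir z) (norm_pos_iff.2 hz)).symm

theorem mem_slitPlane_real_mul {r : ℝ} (hr : 0 < r) {z : ℂ} :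
    (r : ℂ) * z ∈ Complex.slitPlane ↔ z ∈ Complex.slitPlane := by
  rw [Complex.mem_slitPlane_iff, Complex.mem_slitPlane_iff]
  simp [hr, hr.ne']

theorem polarPt_mem_slitPlane {m : ℝ} (hm : 0 < m) {u : ℂ} (hu : u ∈ Complex.slitPlane) :
    polarPt m u ∈ Complex.slitPlane :=
  (mem_slitPlane_real_mul (sqrt_div_pi_pos hm)).2 hu

theorem dir_mem_slitPlane {z : ℂ} (hz : z ∈ Complex.slitPlane) : dir z ∈ Complex.slitPlane := by
  have h0 := Complex.slitPlane_ne_zero hz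
  rw [← mem_slitPlane_real_mul (norm_pos_iff.2 h0), dir_mul_norm h0]
  exact hz

/-- The differential of the angular coordinate (in radians). -/
noncomputable def dAngle (z : ℂ) : ℂ →L[ℝ] ℝ := (‖z‖ ^ 2)⁻¹ • areaFormL z

theorem dAngle_apply (z w : ℂ) : dAngle z w = areaForm z w / ‖z‖ ^ 2 := by
  simp [dAngle, areaFormL_apply, div_eq_inv_mul]

theorem dAngle_eq_im {z : ℂ} (w : ℂ) : dAngle z w = (z⁻¹ * w).im := by
  rw [dAngle_apply, ← Complex.normSq_eq_norm_sq, areaForm, Complex.mul_im, Complex.inv_re,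
    Complex.inv_im]
  ring

theorem areaForm_eq_dAngle {z : ℂ} (hz : z ≠ 0) (w : ℂ) :
    areaForm z w = ‖z‖ ^ 2 * dAngle z w := by
  have := norm_ne_zero_iff.2 hz
  rw [dAngle_apply]; field_simp

theorem hasFDerivAt_arg {z : ℂ} (hz : z ∈ Complex.slitPlane) :
    HasFDerivAt Complex.arg (dAngle z) z := by
  have h1 := (Complex.hasDerivAt_log hz).hasFDerivAt.restrictScalars ℝ
  have h2 := Complex.imCLM.hasFDerivAt.comp z h1
  have h3 : (Complex.imCLM ∘ Complex.log) = Complex.arg := by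
    ext z; simp [Complex.log_im]
  rw [h3] at h2
  refine h2.congr_fderiv ?_
  ext w
  simp [dAngle_eq_im, mul_comm]

theorem contDiffAt_arg {z : ℂ} (hz : z ∈ Complex.slitPlane) : ContDiffAt ℝ ∞ Complex.arg z := by
  have h1 : ContDiffAt ℝ ∞ Complex.log z := (Complex.contDiffAt_log hz).restrict_scalars ℝ
  have h3 : (fun z => Complex.imCLM (Complex.log z)) = Complex.arg := by
    ext z; simp [Complex.log_im]
  rw [← h3]
  exact Complex.imCLM.contDiff.contDiffAt.comp z h1

theorem contDiffAt_dir {z : ℂ} (hz : z ≠ 0) : ContDiffAt ℝ ∞ dir z := by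
  have h1 : ContDiffAt ℝ ∞ (fun z : ℂ => ((‖z‖ : ℝ) : ℂ)) z :=
    Complex.ofRealCLM.contDiff.contDiffAt.comp z (contDiffAt_norm ℝ hz)
  have h2 := h1.inv (by exact_mod_cast norm_ne_zero_iff.2 hz)
  have h3 : dir = fun z : ℂ => z * ((‖z‖ : ℝ) : ℂ)⁻¹ := by
    ext z; rw [dir, div_eq_mul_inv]
  rw [h3]
  exact contDiffAt_id.mul h2

theorem hasFDerivAt_dir {z : ℂ} (hz : z ≠ 0) :
    HasFDerivAt dir ((dAngle z).smulRight (Complex.I * dir z)) z := by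
  have hn : (‖z‖ : ℂ) ≠ 0 := by exact_mod_cast norm_ne_zero_iff.2 hz
  obtain ⟨T, hT⟩ := (contDiffAt_norm ℝ hz (n := 1)).differentiableAt (by simp)
  obtain ⟨D, hD⟩ := (contDiffAt_dir hz).differentiableAt (by simp)
  refine hD.congr_fderiv ?_
  -- `z = ‖z‖ * dir z` and `1 = dir z * conj (dir z)` determine the derivative
  have h1 := (Complex.ofRealCLM.hasFDerivAt.comp z hT).mul hD
  have h2 : HasFDerivAt (fun z : ℂ => ((‖z‖ : ℝ) : ℂ) * dir z) (ContinuousLinearMap.id ℝ ℂ) z := by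
    refine (hasFDerivAt_id z).congr_of_eventuallyEq ?_
    filter_upwards [isOpen_ne.mem_nhds hz] with y hy using dir_mul_norm hy
  have h3 : ∀ w, (‖z‖ : ℂ) * D w + (T w : ℂ) * dir z = w := by
    intro w
    have := congrArg (fun S => S w) (h1.unique h2)
    simpa [mul_comm] using this
  have hnd : ∀ y : ℂ, y ≠ 0 → (dir y).re ^ 2 + (dir y).im ^ 2 = 1 := by
    intro y hy
    have := norm_dir hy
    have h := Complex.sq_norm (dir y)
    rw [this, Complex.normSq_apply] at h
    linarith
  have h4 : HasFDerivAt (fun y => (dir y).re ^ 2 + (dir y).im ^ 2) (0 : ℂ →L[ℝ] ℝ) z := by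
    refine (hasFDerivAt_const (1 : ℝ) z).congr_of_eventuallyEq ?_
    filter_upwards [isOpen_ne.mem_nhds hz] with y hy using hnd y hy
  have h5 := ((Complex.reCLM.hasFDerivAt.comp z hD).pow 2).add
    ((Complex.imCLM.hasFDerivAt.comp z hD).pow 2)
  have h6 : ∀ w, (dir z).re * (D w).re + (dir z).im * (D w).im = 0 := by
    intro w
    have := congrArg (fun S => S w) (h5.unique h4)
    simp at this
    linarith
  have hne : ‖z‖ ≠ 0 := norm_ne_zero_iff.2 hz
  apply ContinuousLinearMap.ext
  intro w
  have e1 := congrArg Complex.re (h3 w)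
  have e2 := congrArg Complex.im (h3 w)
  have e3 := hnd z hz
  have e4 := h6 w
  have e5 : dAngle z w * ‖z‖ = (dir z).re * w.im - (dir z).im * w.re := by
    rw [dAngle_apply, areaForm]
    have r1 : z.re = ‖z‖ * (dir z).re := by
      conv_lhs => rw [← dir_mul_norm hz]
      simp
    have r2 : z.im = ‖z‖ * (dir z).im := by
      conv_lhs => rw [← dir_mul_norm hz]
      simp
    rw [r1, r2]; field_simp
  simp only [Complex.add_re, Complex.add_im, Complex.re_ofReal_mul, Complex.im_ofReal_mul] at e1 e2
  rw [ContinuousLinearMap.smulRight_apply, Complex.real_smul]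
  set c := (dir z).re
  set s := (dir z).im
  rw [← e1, ← e2] at e5
  have e6 : dAngle z w = c * (D w).im - s * (D w).re := by
    apply mul_right_cancel₀ hne
    rw [e5]; ring
  have i1 : (Complex.I * dir z).re = -s := by simp [s]
  have i2 : (Complex.I * dir z).im = c := by simp [c]
  apply Complex.ext
  · rw [Complex.re_ofReal_mul, i1, e6]
    linear_combination -(D w).re * e3 + c * e4
  · rw [Complex.im_ofReal_mul, i2, e6]
    linear_combination -(D w).im * e3 + s * e4

theorem contDiffAt_polarPt {G : Type*} [NormedAddCommGroup G] [NormedSpace ℝ G] {m : G → ℝ}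
    {u : G → ℂ} {x : G} (hm : ContDiffAt ℝ ∞ m x) (hu : ContDiffAt ℝ ∞ u x) (hpos : 0 < m x) :
    ContDiffAt ℝ ∞ (fun y => polarPt (m y) (u y)) x := by
  refine ContDiffAt.mul ?_ hu
  exact Complex.ofRealCLM.contDiff.contDiffAt.comp x
    ((hm.div_const Real.pi).sqrt (by positivity))

theorem continuousAt_polarPt {G : Type*} [TopologicalSpace G] {m : G → ℝ} {u : G → ℂ} {x : G}
    (hm : ContinuousAt m x) (hu : ContinuousAt u x) :
    ContinuousAt (fun y => polarPt (m y) (u y)) x := by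
  unfold polarPt
  exact (Complex.continuous_ofReal.continuousAt.comp
    (Real.continuous_sqrt.continuousAt.comp (hm.div_const _))).mul hu

/-- The velocity of a curve in polar coordinates. -/
theorem hasDerivAt_polarPt {m : ℝ → ℝ} {u : ℝ → ℂ} {m' α' τ : ℝ} (hm : HasDerivAt m m' τ)
    (hu : HasDerivAt u (α' * (Complex.I * u τ)) τ) (hpos : 0 < m τ) :
    HasDerivAt (fun t => polarPt (m t) (u t))
      (((m' / (2 * m τ) : ℝ) + α' * Complex.I) * polarPt (m τ) (u τ)) τ := by
  have h1 : HasDerivAt (fun t => Real.sqrt (m t / Real.pi))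
      (m' / (2 * m τ) * Real.sqrt (m τ / Real.pi)) τ := by
    have hp : 0 < m τ / Real.pi := by positivity
    refine ((hm.div_const Real.pi).sqrt hp.ne').congr_deriv ?_
    have hs := Real.sq_sqrt hp.le
    have hs0 := (Real.sqrt_pos.2 hp).ne'
    have hpi := Real.pi_ne_zero
    field_simp
    field_simp at hs
    linear_combination -m' * hs
  refine (h1.ofReal_comp.mul hu).congr_deriv ?_
  simp only [polarPt]
  push_cast
  ring

theorem areaForm_self_mul (r α : ℝ) (z : ℂ) :
    areaForm z ((r + α * Complex.I) * z) = α * ‖z‖ ^ 2 := by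
  rw [← Complex.normSq_eq_norm_sq, Complex.normSq_apply, areaForm]
  simp
  ring

/-- The primitive `½ areaForm(z, dz)` is `m dα / 2π` in polar coordinates. -/
theorem areaForm_polarPt {m α' : ℝ} (r : ℝ) {u : ℂ} (hu : ‖u‖ = 1) (hpos : 0 < m) :
    1 / 2 * areaForm (polarPt m u) ((r + α' * Complex.I) * polarPt m u)
      = m * (α' / (2 * Real.pi)) := by
  rw [areaForm_self_mul, norm_polarPt hu, Real.sq_sqrt (by positivity)]
  field_simp

/-- Radial motion with constant speed `c` in the area coordinate is the Hamiltonian motion of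
`c / 2π` times the angle. -/
theorem hasDerivAt_radial {m c τ : ℝ} {u : ℂ} (hu : ‖u‖ = 1) (hpos : 0 < m + τ * c) :
    ∃ V : ℂ, HasDerivAt (fun t => polarPt (m + t * c) u) V τ ∧
      ∀ w, areaForm V w = c / (2 * Real.pi) * dAngle (polarPt (m + τ * c) u) w := by
  have h1 : HasDerivAt (fun t => m + t * c) c τ := by
    simpa using ((hasDerivAt_id τ).mul_const c).const_add m
  have h2 : HasDerivAt (fun _ : ℝ => u) ((0 : ℝ) * (Complex.I * u)) τ := by
    simpa using hasDerivAt_const τ u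
  refine ⟨_, hasDerivAt_polarPt h1 h2 hpos, fun w => ?_⟩
  rw [dAngle_apply, norm_polarPt hu, Real.sq_sqrt (by positivity)]
  generalize polarPt (m + τ * c) u = z
  simp only [areaForm, Complex.ofReal_zero, zero_mul, add_zero, Complex.re_ofReal_mul,
    Complex.im_ofReal_mul]
  field_simp

theorem exists_polarPt_of_area {m : ℝ} (hm : 0 < m) {z : ℂ} (hz : Real.pi * ‖z‖ ^ 2 = m) :
    ∃ u : Circle, z = polarPt m u := by
  have h0 : z ≠ 0 := by
    rintro rfl
    simp at hz
    exact hm.ne hz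
  refine ⟨⟨dir z, mem_sphere_zero_iff_norm.2 (norm_dir h0)⟩, ?_⟩
  rw [← hz]
  exact (polarPt_area_dir h0).symm

/-! ### The notched circle -/

/-- The ratio of the Poisson-type kernel `Re (q u / (1 + q u))` that produces the notch; the notch
at `u = -1` has depth such that the area coordinate there is `(ε / 800) ^ 2 / 4`. -/
noncomputable def notchRatio (ε : ℝ) : ℝ :=
  (1 - (ε / 800) ^ 2 / 4) / (1 - (ε / 800) ^ 2 / 4 + ε / 400)

/-- The kernel `Re (q u / (1 + q u))`, the derivative of the angle of `1 + q u` with respect to that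
of `u`. -/
noncomputable def notchKernel (ε : ℝ) (u : ℂ) : ℝ :=
  (notchRatio ε * u / (1 + notchRatio ε * u)).re

/-- The area coordinate, as a function of the direction `u`, of a star-shaped curve of area `1` that
is nearly the circle of area `1`, except for a narrow notch reaching close to the origin in
direction `-1`. -/
noncomputable def notchedArea (ε : ℝ) (u : ℂ) : ℝ := 1 + ε / 400 * notchKernel ε u

/-- The distance by which the notched curve is shifted, so that it leaves the half-line `(-∞, 0]`. -/
noncomputable def notchShift (ε : ℝ) : ℝ := ε / 800 / Real.sqrt Real.pi

/-- The point in direction `u` of the star-shaped curve with a notch. -/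
noncomputable def notchedPt (ε : ℝ) (u : ℂ) : ℂ := polarPt (notchedArea ε u) u

theorem notchRatio_mem {ε : ℝ} (h0 : 0 < ε) (h1 : ε ≤ 1) :
    0 < notchRatio ε ∧ notchRatio ε < 1 := by
  have : (0 : ℝ) < 1 - (ε / 800) ^ 2 / 4 := by nlinarith
  unfold notchRatio
  refine ⟨by positivity, ?_⟩
  rw [div_lt_one (by positivity)]
  linarith

theorem mul_notchRatio {ε : ℝ} (h0 : 0 < ε) (h1 : ε ≤ 1) :
    ε / 400 * notchRatio ε = (1 - (ε / 800) ^ 2 / 4) * (1 - notchRatio ε) := by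
  have : (0 : ℝ) < 1 - (ε / 800) ^ 2 / 4 := by nlinarith
  have h2 : 1 - (ε / 800) ^ 2 / 4 + ε / 400 ≠ 0 := by positivity
  unfold notchRatio
  generalize 1 - (ε / 800) ^ 2 / 4 = d at h2 ⊢
  generalize ε / 400 = k at h2 ⊢
  field_simp
  ring

theorem one_add_mul_re_pos {q : ℝ} (hq0 : 0 < q) (hq1 : q < 1) {u : ℂ} (hu : ‖u‖ = 1) :
    0 < (1 + q * u).re := by
  have h1 : -1 ≤ u.re := by
    have := Complex.abs_re_le_norm u
    rw [hu] at this
    exact (abs_le.1 this).1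
  simp only [Complex.add_re, Complex.one_re, Complex.re_ofReal_mul]
  nlinarith

theorem one_add_notchRatio_mul_mem {ε : ℝ} (h0 : 0 < ε) (h1 : ε ≤ 1) {u : ℂ} (hu : ‖u‖ = 1) :
    1 + notchRatio ε * u ∈ Complex.slitPlane :=
  Or.inl (one_add_mul_re_pos (notchRatio_mem h0 h1).1 (notchRatio_mem h0 h1).2 hu)

theorem re_sq_add_im_sq {u : ℂ} (hu : ‖u‖ = 1) : u.re ^ 2 + u.im ^ 2 = 1 := by
  have h := Complex.sq_norm u
  rw [hu, Complex.normSq_apply] at h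
  linarith

theorem notchKernel_eq {ε : ℝ} {u : ℂ} (hu : ‖u‖ = 1) :
    notchKernel ε u = (notchRatio ε * u.re + notchRatio ε ^ 2) /
      (1 + 2 * notchRatio ε * u.re + notchRatio ε ^ 2) := by
  have h := re_sq_add_im_sq hu
  have hn : Complex.normSq (1 + notchRatio ε * u)
      = 1 + 2 * notchRatio ε * u.re + notchRatio ε ^ 2 := by
    rw [Complex.normSq_apply]
    simp only [Complex.add_re, Complex.one_re, Complex.re_ofReal_mul, Complex.add_im,
      Complex.one_im, Complex.im_ofReal_mul]
    linear_combination notchRatio ε ^ 2 * h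
  rw [notchKernel, Complex.div_re, hn, ← add_div]
  congr 1
  simp only [Complex.add_re, Complex.one_re, Complex.re_ofReal_mul, Complex.add_im,
      Complex.one_im, Complex.im_ofReal_mul]
  linear_combination notchRatio ε ^ 2 * h

theorem notchedArea_bounds {ε : ℝ} (h0 : 0 < ε) (h1 : ε ≤ 1) {u : ℂ} (hu : ‖u‖ = 1) :
    (ε / 800) ^ 2 / 4 ≤ notchedArea ε u ∧ notchedArea ε u ≤ 1 + ε / 800 := by
  obtain ⟨q0, q1⟩ := notchRatio_mem h0 h1
  have hc : -1 ≤ u.re := by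
    have := Complex.abs_re_le_norm u
    rw [hu] at this
    exact (abs_le.1 this).1
  have hη : (0 : ℝ) < 1 - (ε / 800) ^ 2 / 4 := by nlinarith
  have hq : ε / 400 * notchRatio ε = (1 - (ε / 800) ^ 2 / 4) * (1 - notchRatio ε) :=
    mul_notchRatio h0 h1
  rw [notchedArea, notchKernel_eq hu]
  set q := notchRatio ε
  have hden : 0 < 1 + 2 * q * u.re + q ^ 2 := by nlinarith
  have up : (q * u.re + q ^ 2) / (1 + 2 * q * u.re + q ^ 2) ≤ 1 / 2 := by
    rw [div_le_div_iff₀ hden (by norm_num)]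
    nlinarith
  have lo : -(q / (1 - q)) ≤ (q * u.re + q ^ 2) / (1 + 2 * q * u.re + q ^ 2) := by
    rw [← neg_div, div_le_div_iff₀ (by linarith) hden]
    have : 0 ≤ q * (1 + u.re) * (1 + q) := by
      have : 0 ≤ 1 + u.re := by linarith
      positivity
    nlinarith
  have e1 : ε / 400 * (q / (1 - q)) = 1 - (ε / 800) ^ 2 / 4 := by
    rw [← mul_div_assoc, hq, mul_div_assoc, div_self (by linarith), mul_one]
  constructor <;> nlinarith

theorem notchedArea_neg_one {ε : ℝ} (h0 : 0 < ε) (h1 : ε ≤ 1) :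
    notchedArea ε (-1) = (ε / 800) ^ 2 / 4 := by
  obtain ⟨q0, q1⟩ := notchRatio_mem h0 h1
  have hη : (0 : ℝ) < 1 - (ε / 800) ^ 2 / 4 := by nlinarith
  have hq : ε / 400 * notchRatio ε = (1 - (ε / 800) ^ 2 / 4) * (1 - notchRatio ε) :=
    mul_notchRatio h0 h1
  rw [notchedArea, notchKernel_eq (by simp)]
  simp only [Complex.neg_re, Complex.one_re]
  set q := notchRatio ε
  have : (q * -1 + q ^ 2) / (1 + 2 * q * -1 + q ^ 2) = -(q / (1 - q)) := by
    have : 1 - q ≠ 0 := by linarith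
    rw [show 1 + 2 * q * -1 + q ^ 2 = (1 - q) ^ 2 by ring]
    field_simp
    ring
  have e1 : ε / 400 * (q / (1 - q)) = 1 - (ε / 800) ^ 2 / 4 := by
    rw [← mul_div_assoc, hq, mul_div_assoc, div_self (by linarith), mul_one]
  rw [this]; linarith

theorem notchedArea_pos {ε : ℝ} (h0 : 0 < ε) (h1 : ε ≤ 1) {u : ℂ} (hu : ‖u‖ = 1) :
    0 < notchedArea ε u :=
  lt_of_lt_of_le (by positivity) (notchedArea_bounds h0 h1 hu).1

theorem notchShift_pos {ε : ℝ} (h0 : 0 < ε) : 0 < notchShift ε :=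
  div_pos (by positivity) (Real.sqrt_pos.2 Real.pi_pos)

theorem pi_mul_notchShift_sq (ε : ℝ) : Real.pi * notchShift ε ^ 2 = (ε / 800) ^ 2 := by
  have := Real.pi_ne_zero
  rw [notchShift, div_pow, Real.sq_sqrt Real.pi_pos.le]
  field_simp

theorem area_shift_notchedPt_lt {ε : ℝ} (h0 : 0 < ε) (h1 : ε ≤ 1) {u : ℂ} (hu : ‖u‖ = 1) {τ : ℝ}
    (hτ0 : 0 ≤ τ) (hτ1 : τ ≤ 1) :
    Real.pi * ‖notchedPt ε u + ((τ * notchShift ε : ℝ) : ℂ)‖ ^ 2 < 1 + ε / 100 := by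
  have hp := notchShift_pos h0
  have hs : 0 < Real.sqrt Real.pi := Real.sqrt_pos.2 Real.pi_pos
  have hss : Real.sqrt Real.pi ^ 2 = Real.pi := Real.sq_sqrt Real.pi_pos.le
  have a1 : Real.pi * ‖notchedPt ε u‖ ^ 2 ≤ 1 + ε / 800 := by
    rw [notchedPt, area_polarPt (notchedArea_pos h0 h1 hu).le hu]
    exact (notchedArea_bounds h0 h1 hu).2
  have a2 : Real.sqrt Real.pi * ‖notchedPt ε u‖ ≤ 1 + ε / 1600 := by
    apply le_of_sq_le_sq _ (by positivity)
    rw [mul_pow, hss]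
    nlinarith
  have a3 : Real.sqrt Real.pi * notchShift ε = ε / 800 := by
    rw [notchShift]; field_simp
  have a4 : ‖notchedPt ε u + ((τ * notchShift ε : ℝ) : ℂ)‖ ≤ ‖notchedPt ε u‖ + notchShift ε := by
    refine (norm_add_le _ _).trans ?_
    rw [Complex.norm_real, Real.norm_of_nonneg (by positivity)]
    nlinarith
  have a5 : Real.sqrt Real.pi * ‖notchedPt ε u + ((τ * notchShift ε : ℝ) : ℂ)‖
      ≤ 1 + ε / 1600 + ε / 800 := by
    calc _ ≤ Real.sqrt Real.pi * (‖notchedPt ε u‖ + notchShift ε) := by gcongr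
      _ ≤ _ := by rw [mul_add, a3]; linarith
  have a6 : Real.pi * ‖notchedPt ε u + ((τ * notchShift ε : ℝ) : ℂ)‖ ^ 2
      ≤ (1 + ε / 1600 + ε / 800) ^ 2 := by
    rw [← hss, ← mul_pow]
    gcongr
  nlinarith

/-- The shifted curve with a notch. It has area `1`, and it lies in the disk of area `1 + ε / 100`
slit along the negative real axis. -/
noncomputable def slitPt (ε : ℝ) (u : ℂ) : ℂ := notchedPt ε u + notchShift ε

theorem slitPt_area_lt {ε : ℝ} (h0 : 0 < ε) (h1 : ε ≤ 1) {u : ℂ} (hu : ‖u‖ = 1) :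
    Real.pi * ‖slitPt ε u‖ ^ 2 < 1 + ε / 100 := by
  have := area_shift_notchedPt_lt h0 h1 hu zero_le_one le_rfl
  simpa [slitPt] using this

theorem slitPt_mem_slitPlane {ε : ℝ} (h0 : 0 < ε) (h1 : ε ≤ 1) {u : ℂ} (hu : ‖u‖ = 1) :
    slitPt ε u ∈ Complex.slitPlane := by
  by_contra hn
  rw [Complex.mem_slitPlane_iff, not_or, not_lt, not_not] at hn
  obtain ⟨hre, him⟩ := hn
  have hp := notchShift_pos h0
  have hr := sqrt_div_pi_pos (notchedArea_pos h0 h1 hu)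
  have e1 : (slitPt ε u).re = (notchedPt ε u).re + notchShift ε := by simp [slitPt]
  have e2 : (slitPt ε u).im = (notchedPt ε u).im := by simp [slitPt]
  have e3 : (notchedPt ε u).re = Real.sqrt (notchedArea ε u / Real.pi) * u.re := by
    rw [notchedPt, polarPt, Complex.re_ofReal_mul]
  have e4 : (notchedPt ε u).im = Real.sqrt (notchedArea ε u / Real.pi) * u.im := by
    rw [notchedPt, polarPt, Complex.im_ofReal_mul]
  have him0 : u.im = 0 := by
    rw [e2, e4] at him
    exact (mul_eq_zero.1 him).resolve_left hr.ne'
  have hre0 : u.re < 0 := by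
    by_contra hge
    rw [not_lt] at hge
    have : 0 ≤ Real.sqrt (notchedArea ε u / Real.pi) * u.re := by positivity
    linarith
  have hu1 : u = -1 := by
    have := re_sq_add_im_sq hu
    rw [him0] at this
    have h3 : (u.re + 1) * (u.re - 1) = 0 := by linarith
    have h4 : u.re + 1 = 0 := (mul_eq_zero.1 h3).resolve_right (by linarith)
    apply Complex.ext
    · simp; linarith
    · simpa using him0
  have a1 : Real.pi * ‖notchedPt ε u‖ ^ 2 = (ε / 800) ^ 2 / 4 := by
    rw [notchedPt, area_polarPt (notchedArea_pos h0 h1 hu).le hu, hu1, notchedArea_neg_one h0 h1]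
  have a2 : notchShift ε ≤ ‖notchedPt ε u‖ := by
    have := Complex.abs_re_le_norm (notchedPt ε u)
    have := neg_abs_le (notchedPt ε u).re
    linarith
  have a3 : Real.pi * notchShift ε ^ 2 ≤ Real.pi * ‖notchedPt ε u‖ ^ 2 := by
    gcongr
  rw [a1, pi_mul_notchShift_sq] at a3
  have : 0 < (ε / 800) ^ 2 := by positivity
  linarith

/-! ### The twisted torus -/

/-- The amount, depending on the direction `u` of the first coordinate, by which the second
coordinate is pushed outwards. The area coordinate of a slit curve, which is less than
`1 + ε / 100`, is thereby moved to an interval centred at `3 / 2 + ε / 20 * u.re`. -/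
noncomputable def pushArea (ε : ℝ) (u : ℂ) : ℝ := 1 - ε / 200 + ε / 20 * u.re

/-- The angle, depending on the direction `u` of the first coordinate, by which the second
coordinate is rotated. -/
noncomputable def twistAngle (ε : ℝ) (u : ℂ) : ℝ := -ε * (u.re * u.im)

/-- The area coordinate of the second coordinate after the push. -/
noncomputable def outerArea (ε : ℝ) (u z : ℂ) : ℝ := Real.pi * ‖z‖ ^ 2 + pushArea ε u

/-- The part of the area coordinate of the first coordinate that comes from the push, at time `τ`
of the isotopy. -/
noncomputable def pushShift (ε : ℝ) (u z : ℂ) (τ : ℝ) : ℝ :=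
  1 + τ * (-(ε / 20 * u.im * Complex.arg z))

/-- The rate of change of the area coordinate of the first coordinate during the twist. The first
term comes from the rotation of the second coordinate, the term `-ε * u.re` from a Hamiltonian
that depends on the first coordinate only. -/
noncomputable def twistRate (ε : ℝ) (u z : ℂ) : ℝ :=
  ε * ((u.re ^ 2 - u.im ^ 2) * (outerArea ε u z - 3 / 2) - u.re)

/-- The area coordinate of the first coordinate at time `τ` of the twist. -/
noncomputable def innerArea (ε : ℝ) (u z : ℂ) (τ : ℝ) : ℝ :=
  pushShift ε u z 1 + τ * twistRate ε u z

/-- The point at time `τ` of the twist, with first direction `u` and second coordinate pushed out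
from `z`. -/
noncomputable def twistPt (ε : ℝ) (u z : ℂ) (τ : ℝ) : ℂ × ℂ :=
  (polarPt (innerArea ε u z τ) u,
    polarPt (outerArea ε u z) (Complex.exp ((τ * twistAngle ε u : ℝ) * Complex.I) * dir z))

theorem abs_mul_arg_le {ε : ℝ} (h0 : 0 < ε) {u : ℂ} (hu : ‖u‖ = 1) (z : ℂ) :
    |ε / 20 * u.im * Complex.arg z| ≤ 4 / 25 * ε := by
  have h1 : |u.im| ≤ 1 := by rw [← hu]; exact Complex.abs_im_le_norm u
  have h2 : |Complex.arg z| ≤ 16 / 5 := by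
    linarith [Complex.abs_arg_le_pi z, Real.pi_lt_d2]
  rw [abs_mul, abs_mul, abs_of_pos (by positivity : 0 < ε / 20)]
  calc ε / 20 * |u.im| * |Complex.arg z| ≤ ε / 20 * 1 * (16 / 5) := by gcongr
    _ = _ := by ring

theorem re_bounds {u : ℂ} (hu : ‖u‖ = 1) : -1 ≤ u.re ∧ u.re ≤ 1 :=
  abs_le.1 (hu ▸ Complex.abs_re_le_norm u)

theorem pushArea_bounds {ε : ℝ} (h0 : 0 < ε) {u : ℂ} (hu : ‖u‖ = 1) :
    1 - ε / 10 ≤ pushArea ε u ∧ pushArea ε u ≤ 1 + ε / 20 := by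
  obtain ⟨h1, h2⟩ := re_bounds hu
  unfold pushArea
  constructor <;> nlinarith

section Estimates

variable {ε : ℝ} (h0 : 0 < ε) (h1 : ε ≤ 1 / 10) {u z : ℂ} (hu : ‖u‖ = 1) (hz : z ≠ 0)
  (hz1 : Real.pi * ‖z‖ ^ 2 < 1 + ε / 100)

include h0 hu in
theorem pushShift_bounds {τ : ℝ} (hτ0 : 0 ≤ τ) (hτ1 : τ ≤ 1) :
    |pushShift ε u z τ - 1| ≤ 4 / 25 * ε := by
  rw [pushShift, add_sub_cancel_left, abs_mul, abs_neg, abs_of_nonneg hτ0]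
  calc τ * |ε / 20 * u.im * Complex.arg z| ≤ 1 * (4 / 25 * ε) := by
        gcongr; exact abs_mul_arg_le h0 hu z
    _ = _ := one_mul _

include h0 hu hz hz1 in
theorem outerArea_bounds : 1 - ε / 10 < outerArea ε u z ∧ outerArea ε u z < 2 + ε / 10 := by
  obtain ⟨h3, h4⟩ := pushArea_bounds h0 hu
  have : 0 < Real.pi * ‖z‖ ^ 2 := by
    have := norm_pos_iff.2 hz
    have := Real.pi_pos
    positivity
  unfold outerArea
  constructor <;> linarith

include h0 h1 hu hz hz1 in
theorem innerArea_bounds {τ : ℝ} (hτ0 : 0 ≤ τ) (hτ1 : τ ≤ 1) :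
    |innerArea ε u z τ - 1| < 3 * ε := by
  obtain ⟨h3, h4⟩ := outerArea_bounds h0 hu hz hz1
  obtain ⟨h5, h6⟩ := re_bounds hu
  have h7 := abs_le.1 (pushShift_bounds (z := z) h0 hu zero_le_one le_rfl)
  have h8 := re_sq_add_im_sq hu
  have h9 : |twistRate ε u z| ≤ 2 * ε := by
    rw [twistRate, abs_mul, abs_of_pos h0, mul_comm 2]
    gcongr
    have e1 : |u.re ^ 2 - u.im ^ 2| ≤ 1 := by
      rw [abs_le]; constructor <;> nlinarith
    have e2 : |outerArea ε u z - 3 / 2| ≤ 1 := by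
      rw [abs_le]; constructor <;> linarith
    have e3 : |u.re| ≤ 1 := abs_le.2 ⟨h5, h6⟩
    calc _ ≤ |(u.re ^ 2 - u.im ^ 2) * (outerArea ε u z - 3 / 2)| + |u.re| := abs_sub _ _
      _ ≤ 1 * 1 + 1 := by rw [abs_mul]; gcongr
      _ = 2 := by norm_num
  have h10 : |τ * twistRate ε u z| ≤ 2 * ε := by
    rw [abs_mul, abs_of_nonneg hτ0]
    calc τ * |twistRate ε u z| ≤ 1 * (2 * ε) := by gcongr
      _ = _ := one_mul _
  have h11 := abs_le.1 h10
  rw [innerArea, abs_lt]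
  constructor <;> linarith

include h0 hu hz1 in
/-- Over the circle of area `2` the first coordinate of the twisted torus stays inside the disk of
area `1`: that circle is only reached where `Re u ≥ -1 / 10`, and there the rate
`ε * ((Re u) ^ 2 - Re u - 1 / 2)` of the twist is negative and outweighs the push. -/
theorem innerArea_le_of_outerArea_eq_two (h : outerArea ε u z = 2) :
    innerArea ε u z 1 ≤ 1 - ε / 5 := by
  obtain ⟨h5, h6⟩ := re_bounds hu
  have h7 := abs_le.1 (pushShift_bounds (z := z) h0 hu zero_le_one le_rfl)
  have h8 := re_sq_add_im_sq hu
  have hre : -(1 / 10) ≤ u.re := by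
    rw [outerArea, pushArea] at h
    nlinarith
  rw [innerArea, twistRate, h]
  have h9 : (u.re ^ 2 - u.im ^ 2) * (2 - 3 / 2) - u.re ≤ -(39 / 100) := by nlinarith
  nlinarith

include h0 hu hz in
/-- Over the circle of area `1` the first coordinate of the twisted torus stays outside the disk of
area `1`: that circle is only reached where `Re u ≤ 1 / 10`, and there the rate
`ε * (1 / 2 - (Re u) ^ 2 - Re u)` of the twist is positive and outweighs the push. -/
theorem innerArea_ge_of_outerArea_eq_one (h : outerArea ε u z = 1) :
    1 + ε / 5 ≤ innerArea ε u z 1 := by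
  obtain ⟨h5, h6⟩ := re_bounds hu
  have h7 := abs_le.1 (pushShift_bounds (z := z) h0 hu zero_le_one le_rfl)
  have h8 := re_sq_add_im_sq hu
  have : 0 < Real.pi * ‖z‖ ^ 2 := by
    have := norm_pos_iff.2 hz
    have := Real.pi_pos
    positivity
  have hre : u.re ≤ 1 / 10 := by
    rw [outerArea, pushArea] at h
    nlinarith
  rw [innerArea, twistRate, h]
  have h9 : 39 / 100 ≤ (u.re ^ 2 - u.im ^ 2) * (1 - 3 / 2) - u.re := by nlinarith
  nlinarith

end Estimates

/-! ### Smoothness of the construction -/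

section Smooth

variable {G : Type*} [NormedAddCommGroup G] [NormedSpace ℝ G] {u z : G → ℂ} {τ : G → ℝ} {x : G}
  {ε : ℝ}

theorem contDiffAt_re (hu : ContDiffAt ℝ ∞ u x) : ContDiffAt ℝ ∞ (fun y => (u y).re) x :=
  Complex.reCLM.contDiff.contDiffAt.comp x hu

theorem contDiffAt_im (hu : ContDiffAt ℝ ∞ u x) : ContDiffAt ℝ ∞ (fun y => (u y).im) x :=
  Complex.imCLM.contDiff.contDiffAt.comp x hu

theorem contDiffAt_ofReal (hτ : ContDiffAt ℝ ∞ τ x) :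
    ContDiffAt ℝ ∞ (fun y => ((τ y : ℝ) : ℂ)) x :=
  Complex.ofRealCLM.contDiff.contDiffAt.comp x hτ

theorem contDiffAt_notchedArea (h0 : 0 < ε) (h1 : ε ≤ 1) (hu : ContDiffAt ℝ ∞ u x)
    (hx : ‖u x‖ = 1) : ContDiffAt ℝ ∞ (fun y => notchedArea ε (u y)) x := by
  have h2 := Complex.slitPlane_ne_zero (one_add_notchRatio_mul_mem h0 h1 hx)
  have h3 : ContDiffAt ℝ ∞ (fun y => notchRatio ε * u y) x := contDiffAt_const.mul hu
  have h4 := (contDiffAt_const (c := (1 : ℂ)).add h3).inv h2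
  have h5 := contDiffAt_re (h3.mul h4)
  exact contDiffAt_const.add (contDiffAt_const.mul h5)

theorem contDiffAt_notchedPt (h0 : 0 < ε) (h1 : ε ≤ 1) (hu : ContDiffAt ℝ ∞ u x)
    (hx : ‖u x‖ = 1) : ContDiffAt ℝ ∞ (fun y => notchedPt ε (u y)) x :=
  contDiffAt_polarPt (contDiffAt_notchedArea h0 h1 hu hx) hu (notchedArea_pos h0 h1 hx)

theorem contDiffAt_slitPt (h0 : 0 < ε) (h1 : ε ≤ 1) (hu : ContDiffAt ℝ ∞ u x)
    (hx : ‖u x‖ = 1) : ContDiffAt ℝ ∞ (fun y => slitPt ε (u y)) x :=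
  (contDiffAt_notchedPt h0 h1 hu hx).add contDiffAt_const

theorem contDiffAt_pushArea (hu : ContDiffAt ℝ ∞ u x) :
    ContDiffAt ℝ ∞ (fun y => pushArea ε (u y)) x :=
  contDiffAt_const.add (contDiffAt_const.mul (contDiffAt_re hu))

theorem contDiffAt_twistAngle (hu : ContDiffAt ℝ ∞ u x) :
    ContDiffAt ℝ ∞ (fun y => twistAngle ε (u y)) x :=
  contDiffAt_const.mul ((contDiffAt_re hu).mul (contDiffAt_im hu))

theorem contDiffAt_area (hz : ContDiffAt ℝ ∞ z x) :
    ContDiffAt ℝ ∞ (fun y => Real.pi * ‖z y‖ ^ 2) x :=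
  contDiffAt_const.mul (hz.norm_sq ℝ)

theorem contDiffAt_outerArea (hu : ContDiffAt ℝ ∞ u x) (hz : ContDiffAt ℝ ∞ z x) :
    ContDiffAt ℝ ∞ (fun y => outerArea ε (u y) (z y)) x :=
  (contDiffAt_area hz).add (contDiffAt_pushArea hu)

theorem contDiffAt_pushShift (hu : ContDiffAt ℝ ∞ u x) (hz : ContDiffAt ℝ ∞ z x)
    (hτ : ContDiffAt ℝ ∞ τ x) (hx : z x ∈ Complex.slitPlane) :
    ContDiffAt ℝ ∞ (fun y => pushShift ε (u y) (z y) (τ y)) x :=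
  contDiffAt_const.add (hτ.mul (((contDiffAt_const.mul (contDiffAt_im hu)).mul
    ((contDiffAt_arg hx).comp x hz)).neg))

theorem contDiffAt_innerArea (hu : ContDiffAt ℝ ∞ u x) (hz : ContDiffAt ℝ ∞ z x)
    (hτ : ContDiffAt ℝ ∞ τ x) (hx : z x ∈ Complex.slitPlane) :
    ContDiffAt ℝ ∞ (fun y => innerArea ε (u y) (z y) (τ y)) x :=
  (contDiffAt_pushShift hu hz contDiffAt_const hx).add (hτ.mul (contDiffAt_const.mul
    (((((contDiffAt_re hu).pow 2).sub ((contDiffAt_im hu).pow 2)).mul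
      ((contDiffAt_outerArea hu hz).sub contDiffAt_const)).sub (contDiffAt_re hu))))

theorem contDiffAt_cexp_mul_I (hτ : ContDiffAt ℝ ∞ τ x) :
    ContDiffAt ℝ ∞ (fun y => Complex.exp ((τ y : ℝ) * Complex.I)) x :=
  ((contDiffAt_ofReal hτ).mul contDiffAt_const).cexp

theorem contDiffAt_twistPt (hu : ContDiffAt ℝ ∞ u x) (hz : ContDiffAt ℝ ∞ z x)
    (hτ : ContDiffAt ℝ ∞ τ x) (hx : z x ∈ Complex.slitPlane)
    (hi : 0 < innerArea ε (u x) (z x) (τ x)) (ho : 0 < outerArea ε (u x) (z x)) :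
    ContDiffAt ℝ ∞ (fun y => twistPt ε (u y) (z y) (τ y)) x :=
  (contDiffAt_polarPt (contDiffAt_innerArea hu hz hτ hx) hu hi).prodMk
    (contDiffAt_polarPt (contDiffAt_outerArea hu hz)
      ((contDiffAt_cexp_mul_I (hτ.mul (contDiffAt_twistAngle hu))).mul
        ((contDiffAt_dir (Complex.slitPlane_ne_zero hx)).comp x hz)) ho)

end Smooth

/-! ### The twisted torus is a closed Lagrangian with integral areas -/

/-- The point of the unit circle at angle `t`, measured in turns. -/
noncomputable def turn (t : ℝ) : ℂ := Complex.exp ((2 * Real.pi * t : ℝ) * Complex.I)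

theorem norm_turn (t : ℝ) : ‖turn t‖ = 1 := Complex.norm_exp_ofReal_mul_I _

theorem contDiff_turn : ContDiff ℝ ∞ turn := by
  rw [contDiff_iff_contDiffAt]
  intro t
  exact contDiffAt_cexp_mul_I (contDiffAt_const.mul contDiffAt_id)

theorem hasDerivAt_turn {t : ℝ → ℝ} {t' τ : ℝ} (ht : HasDerivAt t t' τ) :
    HasDerivAt (fun s => turn (t s)) ((2 * Real.pi * t' : ℝ) * (Complex.I * turn (t τ))) τ := by
  have h := (((ht.const_mul (2 * Real.pi)).ofReal_comp).mul_const Complex.I).cexp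
  refine h.congr_deriv ?_
  simp only [turn]
  ring

theorem exists_turn_eq {u : ℂ} (hu : ‖u‖ = 1) : ∃ t, turn t = u := by
  refine ⟨Complex.arg u / (2 * Real.pi), ?_⟩
  have := Complex.norm_mul_exp_arg_mul_I u
  rw [hu, Complex.ofReal_one, one_mul] at this
  rw [turn, mul_div_cancel₀ _ (by positivity), this]

theorem exists_int_of_turn_eq {s t : ℝ} (h : turn s = turn t) : ∃ n : ℤ, s = t + n := by
  rw [turn, turn, Complex.exp_eq_exp_iff_exists_int] at h
  obtain ⟨n, hn⟩ := h
  refine ⟨n, ?_⟩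
  have h2 : (2 * Real.pi * Complex.I : ℂ) ≠ 0 := by simp [Real.pi_ne_zero]
  have h3 : (s : ℂ) = ((t + n : ℝ) : ℂ) := by
    apply mul_left_cancel₀ h2
    push_cast at hn ⊢
    linear_combination hn
  exact Complex.ofReal_injective h3

/-- The angle of `z` in turns, in the branch centred at `t₀`. -/
noncomputable def turnAngle (t₀ : ℝ) (z : ℂ) : ℝ :=
  t₀ + Complex.arg (z * turn (-t₀)) / (2 * Real.pi)

theorem turn_add (s t : ℝ) : turn (s + t) = turn s * turn t := by
  simp only [turn, ← Complex.exp_add]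
  congr 1
  push_cast; ring

theorem turn_turnAngle (t₀ : ℝ) {z : ℂ} (hz : z ≠ 0) : turn (turnAngle t₀ z) = dir z := by
  have h1 : turn (Complex.arg (z * turn (-t₀)) / (2 * Real.pi)) = dir z * turn (-t₀) := by
    rw [turn, mul_div_cancel₀ _ (by positivity)]
    have h := Complex.norm_mul_exp_arg_mul_I (z * turn (-t₀))
    rw [norm_mul, norm_turn, mul_one] at h
    have hn : (‖z‖ : ℂ) ≠ 0 := by exact_mod_cast norm_ne_zero_iff.2 hz
    apply mul_left_cancel₀ hn
    rw [h, ← mul_assoc, dir_mul_norm hz]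
  have h2 : turn t₀ * turn (-t₀) = 1 := by rw [← turn_add]; simp [turn]
  rw [turnAngle, turn_add, h1]
  linear_combination dir z * h2

theorem turnAngle_polarPt {t₀ t m : ℝ} (hm : 0 < m) (ht : |t - t₀| < 1 / 2) :
    turnAngle t₀ (polarPt m (turn t)) = t := by
  rw [abs_lt] at ht
  have hpi := Real.pi_pos
  rw [turnAngle, polarPt, mul_assoc, ← turn_add, Complex.arg_real_mul _ (sqrt_div_pi_pos hm), turn,
    Complex.arg_exp_mul_I, (toIocMod_eq_self _).2]
  · field_simp; ring
  · constructor <;> nlinarith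

theorem polarPt_turn_mul_mem {t₀ m : ℝ} (hm : 0 < m) :
    polarPt m (turn t₀) * turn (-t₀) ∈ Complex.slitPlane := by
  rw [polarPt, mul_assoc, ← turn_add, mem_slitPlane_real_mul (sqrt_div_pi_pos hm)]
  simp [turn]

/-- The twisted torus, as a doubly periodic surface. -/
noncomputable def twistedTorus (ε : ℝ) (x : ℝ × ℝ) : ℂ × ℂ :=
  twistPt ε (turn x.1) (slitPt ε (turn x.2)) 1

/-- The second coordinate of a point of the twisted torus before the twist and the push. -/
noncomputable def untwist (ε : ℝ) (p : ℂ × ℂ) : ℂ :=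
  polarPt (Real.pi * ‖p.2‖ ^ 2 - pushArea ε (dir p.1))
    (Complex.exp ((-twistAngle ε (dir p.1) : ℝ) * Complex.I) * dir p.2)

theorem norm_exp_mul_dir (s : ℝ) {z : ℂ} (hz : z ≠ 0) :
    ‖Complex.exp (s * Complex.I) * dir z‖ = 1 := by
  rw [norm_mul, Complex.norm_exp_ofReal_mul_I, norm_dir hz, one_mul]

section Torus

variable {ε : ℝ} (h0 : 0 < ε) (h1 : ε ≤ 1 / 10)

theorem untwist_twistPt {u z : ℂ} (hu : ‖u‖ = 1) (hz : z ≠ 0) (hi : 0 < innerArea ε u z 1)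
    (ho : 0 < outerArea ε u z) : untwist ε (twistPt ε u z 1) = z := by
  have h2 := norm_exp_mul_dir (1 * twistAngle ε u) hz
  simp only [untwist, twistPt]
  rw [dir_polarPt hi hu, area_polarPt ho.le h2, dir_polarPt ho h2, ← mul_assoc, ← Complex.exp_add,
    outerArea, add_sub_cancel_right]
  have : (-twistAngle ε u : ℝ) * Complex.I + (1 * twistAngle ε u : ℝ) * Complex.I = 0 := by
    push_cast; ring
  rw [this, Complex.exp_zero, one_mul, polarPt_area_dir hz]

include h0 h1

theorem slitPt_facts {u : ℂ} (hu : ‖u‖ = 1) :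
    slitPt ε u ∈ Complex.slitPlane ∧ slitPt ε u ≠ 0 ∧ Real.pi * ‖slitPt ε u‖ ^ 2 < 1 + ε / 100 :=
  ⟨slitPt_mem_slitPlane h0 (by linarith) hu,
    Complex.slitPlane_ne_zero (slitPt_mem_slitPlane h0 (by linarith) hu),
    slitPt_area_lt h0 (by linarith) hu⟩

theorem outerArea_slitPt_pos {u v : ℂ} (hu : ‖u‖ = 1) (hv : ‖v‖ = 1) :
    0 < outerArea ε u (slitPt ε v) := by
  obtain ⟨-, h2, h3⟩ := slitPt_facts h0 h1 hv
  linarith [(outerArea_bounds h0 hu h2 h3).1]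

theorem innerArea_slitPt_pos {u v : ℂ} (hu : ‖u‖ = 1) (hv : ‖v‖ = 1) {τ : ℝ} (hτ0 : 0 ≤ τ)
    (hτ1 : τ ≤ 1) : 0 < innerArea ε u (slitPt ε v) τ := by
  obtain ⟨-, h2, h3⟩ := slitPt_facts h0 h1 hv
  have := (abs_lt.1 (innerArea_bounds h0 h1 hu h2 h3 hτ0 hτ1)).1
  linarith

theorem contDiff_twistedTorus : ContDiff ℝ ∞ (twistedTorus ε) := by
  rw [contDiff_iff_contDiffAt]
  intro x
  have c1 : ContDiffAt ℝ ∞ (fun x : ℝ × ℝ => turn x.1) x :=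
    (contDiff_turn.comp contDiff_fst).contDiffAt
  have c2 : ContDiffAt ℝ ∞ (fun x : ℝ × ℝ => turn x.2) x :=
    (contDiff_turn.comp contDiff_snd).contDiffAt
  exact contDiffAt_twistPt c1 (contDiffAt_slitPt h0 (by linarith) c2 (norm_turn _))
    contDiffAt_const (slitPt_facts h0 h1 (norm_turn _)).1
    (innerArea_slitPt_pos h0 h1 (norm_turn _) (norm_turn _) zero_le_one le_rfl)
    (outerArea_slitPt_pos h0 h1 (norm_turn _) (norm_turn _))

theorem untwist_twistedTorus (x : ℝ × ℝ) : untwist ε (twistedTorus ε x) = slitPt ε (turn x.2) :=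
  untwist_twistPt (norm_turn _) (slitPt_facts h0 h1 (norm_turn _)).2.1
    (innerArea_slitPt_pos h0 h1 (norm_turn _) (norm_turn _) zero_le_one le_rfl)
    (outerArea_slitPt_pos h0 h1 (norm_turn _) (norm_turn _))

theorem dir_twistedTorus (x : ℝ × ℝ) : dir (twistedTorus ε x).1 = turn x.1 :=
  dir_polarPt (innerArea_slitPt_pos h0 h1 (norm_turn _) (norm_turn _) zero_le_one le_rfl)
    (norm_turn _)

theorem isSubmanifoldParam_twistedTorus : IsSubmanifoldParam (twistedTorus ε) := by
  refine ⟨contDiff_twistedTorus h0 h1, fun x => ?_⟩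
  have hin : ∀ y : ℝ × ℝ, 0 < innerArea ε (turn y.1) (slitPt ε (turn y.2)) 1 := fun y =>
    innerArea_slitPt_pos h0 h1 (norm_turn _) (norm_turn _) zero_le_one le_rfl
  have hout : ∀ y : ℝ × ℝ, 0 < outerArea ε (turn y.1) (slitPt ε (turn y.2)) := fun y =>
    outerArea_slitPt_pos h0 h1 (norm_turn _) (norm_turn _)
  have hnot : ∀ t, 0 < notchedArea ε (turn t) := fun t =>
    notchedArea_pos h0 (by linarith) (norm_turn t)
  have hsub : ∀ y : ℝ × ℝ, untwist ε (twistedTorus ε y) - notchShift ε = notchedPt ε (turn y.2) :=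
    fun y => by rw [untwist_twistedTorus h0 h1, slitPt, add_sub_cancel_right]
  refine ⟨fun p => (turnAngle x.1 p.1, turnAngle x.2 (untwist ε p - notchShift ε)), ?_, ?_, ?_⟩
  · set p₀ := twistedTorus ε x with hp₀
    have n1 : p₀.1 ≠ 0 := polarPt_ne_zero (hin x) (norm_turn _)
    have hz := (slitPt_facts h0 h1 (norm_turn x.2)).2.1
    have n2 : p₀.2 ≠ 0 := polarPt_ne_zero (hout x) (norm_exp_mul_dir _ hz)
    have n3 : 0 < Real.pi * ‖p₀.2‖ ^ 2 - pushArea ε (dir p₀.1) := by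
      have e1 : Real.pi * ‖p₀.2‖ ^ 2 = outerArea ε (turn x.1) (slitPt ε (turn x.2)) :=
        area_polarPt (hout x).le (norm_exp_mul_dir _ hz)
      rw [dir_twistedTorus h0 h1, e1, outerArea, add_sub_cancel_right]
      have := norm_pos_iff.2 hz
      have := Real.pi_pos
      positivity
    have smU : ∀ p : ℂ × ℂ, p.1 ≠ 0 → p.2 ≠ 0 →
        0 < Real.pi * ‖p.2‖ ^ 2 - pushArea ε (dir p.1) → ContDiffAt ℝ ∞ (untwist ε) p := by
      intro p m1 m2 m3
      have d1 : ContDiffAt ℝ ∞ (fun p : ℂ × ℂ => dir p.1) p :=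
        (contDiffAt_dir m1).comp p contDiffAt_fst
      have d2 : ContDiffAt ℝ ∞ (fun p : ℂ × ℂ => dir p.2) p :=
        (contDiffAt_dir m2).comp p contDiffAt_snd
      exact contDiffAt_polarPt ((contDiffAt_area contDiffAt_snd).sub (contDiffAt_pushArea d1))
        ((contDiffAt_cexp_mul_I (contDiffAt_twistAngle d1).neg).mul d2) m3
    have cU : ContinuousAt (untwist ε) p₀ := (smU p₀ n1 n2 n3).continuousAt
    have cd : ContinuousAt (fun p : ℂ × ℂ => Real.pi * ‖p.2‖ ^ 2 - pushArea ε (dir p.1)) p₀ :=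
      ((contDiffAt_area contDiffAt_snd).sub (contDiffAt_pushArea
        ((contDiffAt_dir n1).comp p₀ contDiffAt_fst))).continuousAt
    have c1 : ContinuousAt (fun p : ℂ × ℂ => p.1 * turn (-x.1)) p₀ := by fun_prop
    have c2 : ContinuousAt (fun p : ℂ × ℂ => (untwist ε p - notchShift ε) * turn (-x.2)) p₀ :=
      (cU.sub continuousAt_const).mul continuousAt_const
    have s1 : p₀.1 * turn (-x.1) ∈ Complex.slitPlane := polarPt_turn_mul_mem (hin x)
    have s2 : (untwist ε p₀ - notchShift ε) * turn (-x.2) ∈ Complex.slitPlane := by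
      rw [hsub]; exact polarPt_turn_mul_mem (hnot _)
    filter_upwards [continuousAt_fst.eventually (isOpen_ne.mem_nhds n1),
      continuousAt_snd.eventually (isOpen_ne.mem_nhds n2),
      cd.eventually (isOpen_Ioi.mem_nhds n3),
      c1.eventually (Complex.isOpen_slitPlane.mem_nhds s1),
      c2.eventually (Complex.isOpen_slitPlane.mem_nhds s2)] with p m1 m2 m3 m4 m5
    have e1 : ContDiffAt ℝ ∞ (fun p : ℂ × ℂ => p.1 * turn (-x.1)) p :=
      contDiffAt_fst.mul contDiffAt_const
    have e2 : ContDiffAt ℝ ∞ (fun p : ℂ × ℂ => (untwist ε p - notchShift ε) * turn (-x.2)) p :=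
      ((smU p m1 m2 m3).sub contDiffAt_const).mul contDiffAt_const
    exact (contDiffAt_const.add (((contDiffAt_arg m4).comp p e1).div_const _)).prodMk
      (contDiffAt_const.add (((contDiffAt_arg m5).comp p e2).div_const _))
  · filter_upwards [Metric.ball_mem_nhds x (show (0 : ℝ) < 1 / 2 by norm_num)] with y hy
    rw [Metric.mem_ball, Prod.dist_eq, max_lt_iff, Real.dist_eq, Real.dist_eq] at hy
    refine Prod.ext ?_ ?_
    · exact turnAngle_polarPt (hin y) hy.1
    · simp only [hsub]
      exact turnAngle_polarPt (hnot _) hy.2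
  · refine Filter.Eventually.of_forall ?_
    rintro _ ⟨y, rfl⟩
    have n1 : (twistedTorus ε y).1 ≠ 0 := polarPt_ne_zero (hin y) (norm_turn _)
    have n2 : notchedPt ε (turn y.2) ≠ 0 := polarPt_ne_zero (hnot _) (norm_turn _)
    have e1 : turn (turnAngle x.1 (twistedTorus ε y).1) = turn y.1 := by
      rw [turn_turnAngle _ n1, dir_twistedTorus h0 h1]
    have e2 : turn (turnAngle x.2 (untwist ε (twistedTorus ε y) - notchShift ε)) = turn y.2 := by
      rw [hsub, turn_turnAngle _ n2, notchedPt, dir_polarPt (hnot _) (norm_turn _)]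
    conv_lhs => rw [twistedTorus]
    simp only [e1, e2]
    rfl

end Torus

/-- The primitive, in the doubly periodic coordinates, of the pullback of `½ symplForm(x, dx)` to
the twisted torus. Apart from the two coordinates, which belong to the product torus, it is a
function on the torus, with contributions of the push (the term with `pushArea`), the twist (the
next two terms), the notch (the term with `notchRatio`) and the shift (the last term). -/
noncomputable def torusPrimitive (ε : ℝ) (x : ℝ × ℝ) : ℝ :=
  x.1 + x.2 + (pushArea ε (turn x.1) * Complex.arg (slitPt ε (turn x.2)) +
    3 / 2 * twistAngle ε (turn x.1) - ε * (turn x.1).im +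
    ε / 400 * Complex.arg (1 + notchRatio ε * turn x.2)) / (2 * Real.pi) +
    1 / 2 * areaForm (notchShift ε) (notchedPt ε (turn x.2))

theorem areaForm_add_left (u u' v : ℂ) : areaForm (u + u') v = areaForm u v + areaForm u' v := by
  simp only [areaForm, Complex.add_re, Complex.add_im]; ring

section Primitive

variable {ε : ℝ} (h0 : 0 < ε) (h1 : ε ≤ 1 / 10)

include h0 h1

theorem contDiff_torusPrimitive : ContDiff ℝ ∞ (torusPrimitive ε) := by
  rw [contDiff_iff_contDiffAt]
  intro x
  have c1 : ContDiffAt ℝ ∞ (fun x : ℝ × ℝ => turn x.1) x :=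
    (contDiff_turn.comp contDiff_fst).contDiffAt
  have c2 : ContDiffAt ℝ ∞ (fun x : ℝ × ℝ => turn x.2) x :=
    (contDiff_turn.comp contDiff_snd).contDiffAt
  have c3 := contDiffAt_slitPt h0 (by linarith) c2 (norm_turn _)
  have c4 := contDiffAt_notchedPt h0 (by linarith) c2 (norm_turn _)
  have c5 : ContDiffAt ℝ ∞ (fun x : ℝ × ℝ => 1 + notchRatio ε * turn x.2) x :=
    contDiffAt_const.add (contDiffAt_const.mul c2)
  have c6 : ContDiffAt ℝ ∞
      (fun x : ℝ × ℝ => areaForm (notchShift ε) (notchedPt ε (turn x.2))) x := by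
    simp only [← areaFormL_apply]
    exact (areaFormL _).contDiff.contDiffAt.comp x c4
  refine (((contDiffAt_fst.add contDiffAt_snd).add (ContDiffAt.div_const ?_ _)).add
    (contDiffAt_const.mul c6))
  refine ((((contDiffAt_pushArea c1).mul
    ((contDiffAt_arg (slitPt_facts h0 h1 (norm_turn _)).1).comp x c3)).add
    (contDiffAt_const.mul (contDiffAt_twistAngle c1))).sub
    (contDiffAt_const.mul (contDiffAt_im c1))).add
    (contDiffAt_const.mul ((contDiffAt_arg ?_).comp x c5))
  exact one_add_notchRatio_mul_mem h0 (by linarith) (norm_turn _)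

theorem primitive_twistedTorus (x v : ℝ × ℝ) :
    1 / 2 * symplFormL (twistedTorus ε x) (fderiv ℝ (twistedTorus ε) x v)
      = fderiv ℝ (torusPrimitive ε) x v := by
  have h1' : ε ≤ 1 := by linarith
  -- all derivatives are taken along the line `s ↦ x + s v`
  have hline : HasDerivAt (fun s : ℝ => x + s • v) v 0 := by
    simpa using ((hasDerivAt_id (0 : ℝ)).smul_const v).const_add x
  have hl0 : x + (0 : ℝ) • v = x := by simp
  have ht1 : HasDerivAt (fun s : ℝ => (x + s • v).1) v.1 0 := hline.fst
  have ht2 : HasDerivAt (fun s : ℝ => (x + s • v).2) v.2 0 := hline.snd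
  set α₁ : ℝ := 2 * Real.pi * v.1 with hα₁
  set α₂ : ℝ := 2 * Real.pi * v.2 with hα₂
  set u₁ : ℝ → ℂ := fun s => turn (x + s • v).1 with hu₁
  set u₂ : ℝ → ℂ := fun s => turn (x + s • v).2 with hu₂
  have du₁ : HasDerivAt u₁ (α₁ * (Complex.I * u₁ 0)) 0 := hasDerivAt_turn ht1
  have du₂ : HasDerivAt u₂ (α₂ * (Complex.I * u₂ 0)) 0 := hasDerivAt_turn ht2
  have n₁ : ‖u₁ 0‖ = 1 := norm_turn _
  have n₂ : ‖u₂ 0‖ = 1 := norm_turn _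
  have e₁ : u₁ 0 = turn x.1 := by simp [hu₁]
  have e₂ : u₂ 0 = turn x.2 := by simp [hu₂]
  have dre : HasDerivAt (fun s => (u₁ s).re) (-(α₁ * (u₁ 0).im)) 0 := by
    refine (Complex.reCLM.hasFDerivAt.comp_hasDerivAt (0 : ℝ) du₁).congr_deriv ?_
    simp
  have dim : HasDerivAt (fun s => (u₁ s).im) (α₁ * (u₁ 0).re) 0 := by
    refine (Complex.imCLM.hasFDerivAt.comp_hasDerivAt (0 : ℝ) du₁).congr_deriv ?_
    simp
  -- the curve with a notch
  have cu₂ : ContDiffAt ℝ ∞ u₂ 0 := by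
    have : ContDiff ℝ ∞ u₂ := contDiff_turn.comp (by fun_prop)
    exact this.contDiffAt
  have cu₁ : ContDiffAt ℝ ∞ u₁ 0 := by
    have : ContDiff ℝ ∞ u₁ := contDiff_turn.comp (by fun_prop)
    exact this.contDiffAt
  have dρ := ((contDiffAt_notchedArea h0 h1' cu₂ n₂).differentiableAt (by simp)).hasDerivAt
  have dζ := hasDerivAt_polarPt dρ du₂ (notchedArea_pos h0 h1' n₂)
  set ρ' := deriv (fun s => notchedArea ε (u₂ s)) 0
  set r : ℝ := ρ' / (2 * notchedArea ε (u₂ 0))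
  set ζ' : ℂ := (r + α₂ * Complex.I) * notchedPt ε (u₂ 0) with hζ'
  have dζ : HasDerivAt (fun s => notchedPt ε (u₂ s)) ζ' 0 := dζ
  set z : ℝ → ℂ := fun s => slitPt ε (u₂ s) with hz
  have dz : HasDerivAt z ζ' 0 := dζ.add_const _
  obtain ⟨zs, zn, zl⟩ := slitPt_facts h0 h1 n₂
  have dargz : HasFDerivAt Complex.arg (dAngle (z 0)) (z 0) := hasFDerivAt_arg zs
  have darg : HasDerivAt (fun s => Complex.arg (z s)) (dAngle (z 0) ζ') 0 :=
    dargz.comp_hasDerivAt (0 : ℝ) dz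
  have ddir : HasDerivAt (fun s => dir (z s)) (dAngle (z 0) ζ' * (Complex.I * dir (z 0))) 0 := by
    refine ((hasFDerivAt_dir zn).comp_hasDerivAt (0 : ℝ) dz).congr_deriv ?_
    simp [hz]
  have dnotch : HasDerivAt (fun s => Complex.arg (1 + notchRatio ε * u₂ s))
      (α₂ * notchKernel ε (u₂ 0)) 0 := by
    have hs := one_add_notchRatio_mul_mem h0 h1' n₂
    refine ((hasFDerivAt_arg hs).comp_hasDerivAt (0 : ℝ)
      ((du₂.const_mul (notchRatio ε : ℂ)).const_add 1)).congr_deriv ?_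
    rw [dAngle_eq_im, notchKernel, ← Complex.re_ofReal_mul, div_eq_inv_mul]
    have : (1 + (notchRatio ε : ℂ) * u₂ 0)⁻¹ * (notchRatio ε * (α₂ * (Complex.I * u₂ 0)))
        = Complex.I * (α₂ * ((1 + (notchRatio ε : ℂ) * u₂ 0)⁻¹ * (notchRatio ε * u₂ 0))) := by
      ring
    rw [this, Complex.I_mul_im]
  -- push and twist
  have dV : HasDerivAt (fun s => pushArea ε (u₁ s)) (ε / 20 * -(α₁ * (u₁ 0).im)) 0 :=
    (dre.const_mul (ε / 20)).const_add (1 - ε / 200)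
  have dW : HasDerivAt (fun s => twistAngle ε (u₁ s))
      (-(α₁ * (ε * ((u₁ 0).re ^ 2 - (u₁ 0).im ^ 2)))) 0 := by
    refine ((dre.mul dim).const_mul (-ε)).congr_deriv ?_
    ring
  have dv : HasDerivAt (fun s => Complex.exp ((1 * twistAngle ε (u₁ s) : ℝ) * Complex.I) *
      dir (z s)) ((-(α₁ * (ε * ((u₁ 0).re ^ 2 - (u₁ 0).im ^ 2))) + dAngle (z 0) ζ' : ℝ) *
        (Complex.I * (Complex.exp ((1 * twistAngle ε (u₁ 0) : ℝ) * Complex.I) * dir (z 0)))) 0 := by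
    refine ((((dW.const_mul 1).ofReal_comp).mul_const Complex.I).cexp.mul ddir).congr_deriv ?_
    push_cast
    ring
  -- the two coordinates of the torus
  have pi1 := innerArea_slitPt_pos h0 h1 n₁ n₂ zero_le_one le_rfl
  have po1 := outerArea_slitPt_pos h0 h1 n₁ n₂
  have cz : ContDiffAt ℝ ∞ z 0 := contDiffAt_slitPt h0 h1' cu₂ n₂
  have dm1 := ((contDiffAt_innerArea (ε := ε) (τ := fun _ => 1) cu₁ cz contDiffAt_const
    zs).differentiableAt (by simp)).hasDerivAt
  have dm2 := ((contDiffAt_outerArea (ε := ε) cu₁ cz).differentiableAt (by simp)).hasDerivAt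
  have d1 := hasDerivAt_polarPt dm1 du₁ pi1
  have d2 := hasDerivAt_polarPt dm2 dv po1
  have dF : HasDerivAt (fun s : ℝ => twistedTorus ε (x + s • v))
      (fderiv ℝ (twistedTorus ε) x v) 0 := by
    have h := ((contDiff_twistedTorus h0 h1).differentiable (by simp) x).hasFDerivAt
    rw [← hl0] at h
    have h2 := h.comp_hasDerivAt (0 : ℝ) hline
    rw [hl0] at h2
    exact h2
  have hF := dF.unique (d1.prodMk d2)
  have hF0 : twistedTorus ε x = (polarPt (innerArea ε (u₁ 0) (z 0) 1) (u₁ 0),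
      polarPt (outerArea ε (u₁ 0) (z 0)) (Complex.exp ((1 * twistAngle ε (u₁ 0) : ℝ) * Complex.I) *
        dir (z 0))) := by
    rw [twistedTorus, twistPt, hz]
    simp only [e₁, e₂]
  -- the primitive
  have dκ : HasDerivAt (fun s : ℝ => torusPrimitive ε (x + s • v))
      (fderiv ℝ (torusPrimitive ε) x v) 0 := by
    have h := ((contDiff_torusPrimitive h0 h1).differentiable (by simp) x).hasFDerivAt
    rw [← hl0] at h
    have h2 := h.comp_hasDerivAt (0 : ℝ) hline
    rw [hl0] at h2
    exact h2
  have dA : HasDerivAt (fun s => areaForm (notchShift ε) (notchedPt ε (u₂ s)))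
      (areaForm (notchShift ε) ζ') 0 := by
    simp only [← areaFormL_apply]
    exact (areaFormL _).hasFDerivAt.comp_hasDerivAt (0 : ℝ) dζ
  have hκ := dκ.unique (((ht1.add ht2).add ((((dV.mul darg).add (dW.const_mul (3 / 2))).sub
    (dim.const_mul ε)).add (dnotch.const_mul (ε / 400)) |>.div_const (2 * Real.pi))).add
    (dA.const_mul (1 / 2)))
  rw [hκ, symplFormL_apply, symplForm, hF, hF0, mul_add]
  simp only
  rw [areaForm_polarPt _ n₁ pi1, areaForm_polarPt _ (norm_exp_mul_dir _ zn) po1]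
  have hself : 1 / 2 * areaForm (notchedPt ε (u₂ 0)) ζ'
      = notchedArea ε (u₂ 0) * (α₂ / (2 * Real.pi)) :=
    areaForm_polarPt r n₂ (notchedArea_pos h0 h1' n₂)
  have hzz : areaForm (z 0) ζ' = areaForm (notchedPt ε (u₂ 0)) ζ' + areaForm (notchShift ε) ζ' :=
    areaForm_add_left _ _ _
  rw [areaForm_eq_dAngle zn] at hzz
  have hv1 : v.1 = α₁ / (2 * Real.pi) := by rw [hα₁]; field_simp
  have hv2 : v.2 = α₂ / (2 * Real.pi) := by rw [hα₂]; field_simp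
  have hpi := Real.pi_ne_zero
  rw [hv1, hv2, innerArea, twistRate, pushShift, outerArea]
  rw [notchedArea] at hself
  generalize pushArea ε (u₁ 0) = V at *
  generalize dAngle (z 0) ζ' = D at *
  generalize notchKernel ε (u₂ 0) = h at *
  generalize areaForm (notchShift ε) ζ' = S at *
  have hn2 : ‖z 0‖ ^ 2 * D = 2 * ((1 + ε / 400 * h) * (α₂ / (2 * Real.pi))) + S := by
    rw [← hself]; linarith
  generalize ‖z 0‖ ^ 2 = N at *
  field_simp at hn2 ⊢
  linear_combination 40 * hn2

end Primitive

section IntegralLagrangian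

variable {ε : ℝ} (h0 : 0 < ε) (h1 : ε ≤ 1 / 10)

include h0 h1

theorem exists_int_of_twistedTorus_eq {x y : ℝ × ℝ} (h : twistedTorus ε x = twistedTorus ε y) :
    ∃ n : ℤ, torusPrimitive ε x = torusPrimitive ε y + n := by
  have e1 : turn x.1 = turn y.1 := by
    rw [← dir_twistedTorus h0 h1, h, dir_twistedTorus h0 h1]
  have e2 : slitPt ε (turn x.2) = slitPt ε (turn y.2) := by
    rw [← untwist_twistedTorus h0 h1, h, untwist_twistedTorus h0 h1]
  have e3 : turn x.2 = turn y.2 := by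
    have hd : ∀ t, dir (notchedPt ε (turn t)) = turn t := fun t =>
      dir_polarPt (notchedArea_pos h0 (by linarith) (norm_turn t)) (norm_turn t)
    rw [← hd x.2, ← hd y.2, add_right_cancel e2]
  obtain ⟨m, hm⟩ := exists_int_of_turn_eq e1
  obtain ⟨n, hn⟩ := exists_int_of_turn_eq e3
  refine ⟨m + n, ?_⟩
  rw [torusPrimitive, torusPrimitive, e1, e3, hm, hn]
  push_cast
  ring

theorem area_fst_twistedTorus (x : ℝ × ℝ) : Real.pi * ‖(twistedTorus ε x).1‖ ^ 2
    = innerArea ε (turn x.1) (slitPt ε (turn x.2)) 1 :=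
  area_polarPt (innerArea_slitPt_pos h0 h1 (norm_turn _) (norm_turn _) zero_le_one le_rfl).le
    (norm_turn _)

theorem area_snd_twistedTorus (x : ℝ × ℝ) : Real.pi * ‖(twistedTorus ε x).2‖ ^ 2
    = outerArea ε (turn x.1) (slitPt ε (turn x.2)) :=
  area_polarPt (outerArea_slitPt_pos h0 h1 (norm_turn _) (norm_turn _)).le
    (norm_exp_mul_dir _ (slitPt_facts h0 h1 (norm_turn _)).2.1)

theorem isCompact_range_twistedTorus : IsCompact (Set.range (twistedTorus ε)) := by
  -- by periodicity the unit square suffices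
  have hr : Set.range (twistedTorus ε) = twistedTorus ε '' Set.Icc ((0, 0) : ℝ × ℝ) (1, 1) := by
    refine subset_antisymm ?_ (Set.image_subset_range _ _)
    rintro _ ⟨x, rfl⟩
    have hfr : ∀ t, turn (Int.fract t) = turn t := fun t => by
      rw [turn, turn, Complex.exp_eq_exp_iff_exists_int]
      refine ⟨-⌊t⌋, ?_⟩
      rw [← Int.self_sub_floor]
      push_cast
      ring
    refine ⟨(Int.fract x.1, Int.fract x.2), ⟨⟨Int.fract_nonneg _, Int.fract_nonneg _⟩,
      (Int.fract_lt_one _).le, (Int.fract_lt_one _).le⟩, ?_⟩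
    simp only [twistedTorus, hfr]
  rw [hr]
  exact isCompact_Icc.image (contDiff_twistedTorus h0 h1).continuous

theorem isIntegralLagrangian_twistedTorus {a b : ℝ} (ha : 1 + 3 * ε ≤ a) (hb : 2 + ε / 10 ≤ b) :
    IsIntegralLagrangian (polydisk a b) (Set.range (twistedTorus ε)) := by
  have hf := isSubmanifoldParam_twistedTorus h0 h1
  have hκ := contDiff_torusPrimitive h0 h1
  have hprim := primitive_twistedTorus h0 h1
  refine ⟨⟨?_, isCompact_range_twistedTorus h0 h1,
    isConnected_range (contDiff_twistedTorus h0 h1).continuous, ?_, ?_⟩, ?_⟩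
  · rintro _ ⟨x, rfl⟩
    obtain ⟨-, s2, s3⟩ := slitPt_facts h0 h1 (norm_turn x.2)
    have i := abs_lt.1 (innerArea_bounds h0 h1 (norm_turn x.1) s2 s3 zero_le_one le_rfl)
    have o := outerArea_bounds h0 (norm_turn x.1) s2 s3
    refine ⟨?_, ?_⟩
    · rw [area_fst_twistedTorus h0 h1]; linarith
    · rw [area_snd_twistedTorus h0 h1]; linarith
  · have h := hf.isSmoothSubmanifold
    rwa [Module.finrank_prod, Module.finrank_self] at h
  · rintro _ ⟨x, rfl⟩ u hu v hv
    obtain ⟨u, rfl⟩ := hf.exists_eq_fderiv x hu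
    obtain ⟨v, rfl⟩ := hf.exists_eq_fderiv x hv
    rw [← symplFormL_apply]
    exact eq_zero_of_primitive_exact symplFormL_swap (contDiff_twistedTorus h0 h1) hκ hprim x u v
  · exact hasIntegralAreas_of_primitive (fun u v => (symplFormL_apply u v).symm) symplFormL_swap hf
      hκ hprim (fun x y => exists_int_of_twistedTorus_eq h0 h1) _

end IntegralLagrangian

/-! ### The Hamiltonian isotopy from the product torus to the twisted torus -/

/-- A version of `HamiltonianIsotopic.of_trajectories` for a compact family of trajectories. -/
theorem HamiltonianIsotopic.of_compact_family {E : Type*} [NormedAddCommGroup E] [NormedSpace ℝ E]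
    [FiniteDimensional ℝ E] {Ω : E → E → ℝ}
    {B : E →L[ℝ] E →L[ℝ] ℝ} {J : (E →L[ℝ] ℝ) →L[ℝ] E} (hΩ : ∀ u v, Ω u v = B u v)
    (hBJ : ∀ ℓ, B (J ℓ) = ℓ) (hJB : ∀ V, J (B V) = V)
    {U O : Set E} (hU : IsOpen U) (hO : IsOpen O) {H : E → ℝ} (hH : ContDiffOn ℝ ∞ H O)
    {X : Type*} [TopologicalSpace X] [CompactSpace X] {c : X → ℝ → E}
    (hcont : ∀ x, ∀ τ ∈ Set.Icc (0 : ℝ) 1, ContinuousAt (fun p : X × ℝ => c p.1 p.2) (x, τ))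
    (hmem : ∀ x, ∀ τ ∈ Set.Icc (0 : ℝ) 1, c x τ ∈ U ∩ O)
    (hflow : ∀ x, ∀ τ ∈ Set.Icc (0 : ℝ) 1, ∃ V : E, ∃ ℓ : E →L[ℝ] ℝ, HasDerivAt (c x) V τ ∧
      HasFDerivAt H ℓ (c x τ) ∧ ∀ w, Ω V w = ℓ w) :
    HamiltonianIsotopic Ω U (Set.range fun x => c x 0) (Set.range fun x => c x 1) := by
  have hK : IsCompact ((fun p : X × ℝ => c p.1 p.2) '' (Set.univ ×ˢ Set.Icc (0 : ℝ) 1)) :=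
    (isCompact_univ.prod isCompact_Icc).image_of_continuousOn fun p hp =>
      (hcont p.1 p.2 hp.2).continuousWithinAt
  refine HamiltonianIsotopic.of_trajectories hΩ hBJ hJB hU hO hH hK ?_ ?_
    (fun x τ hτ => ⟨(x, τ), ⟨trivial, hτ⟩, rfl⟩) fun x τ hτ => ?_
  · rintro _ ⟨p, hp, rfl⟩
    exact (hmem p.1 p.2 hp.2).1
  · rintro _ ⟨p, hp, rfl⟩
    exact (hmem p.1 p.2 hp.2).2
  · obtain ⟨V, ℓ, h1, h2, h3⟩ := hflow x τ hτ
    exact ⟨V, h1, fun w => by rw [h2.fderiv, h3]⟩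

theorem isOpen_polydisk (a b : ℝ) : IsOpen (polydisk a b) :=
  (isOpen_lt (f := fun z : ℂ × ℂ => Real.pi * ‖z.1‖ ^ 2) (by fun_prop) continuous_const).inter
    (isOpen_lt (f := fun z : ℂ × ℂ => Real.pi * ‖z.2‖ ^ 2) (by fun_prop) continuous_const)

/-- A smooth family of tori, parametrised by two unit vectors and following the flow of a
Hamiltonian, is a Hamiltonian isotopy. -/
theorem hamiltonianIsotopic_torusFamily {U O : Set (ℂ × ℂ)} (hU : IsOpen U) (hO : IsOpen O)
    {H : ℂ × ℂ → ℝ} (hH : ContDiffOn ℝ ∞ H O) {F : ℂ → ℂ → ℝ → ℂ × ℂ}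
    (hF : ∀ u v τ, ‖u‖ = 1 → ‖v‖ = 1 → 0 ≤ τ → τ ≤ 1 →
      ContDiffAt ℝ ∞ (fun p : ℂ × ℂ × ℝ => F p.1 p.2.1 p.2.2) (u, v, τ))
    (hmem : ∀ u v τ, ‖u‖ = 1 → ‖v‖ = 1 → 0 ≤ τ → τ ≤ 1 → F u v τ ∈ U ∩ O)
    (hflow : ∀ u v τ, ‖u‖ = 1 → ‖v‖ = 1 → 0 ≤ τ → τ ≤ 1 → ∃ V : ℂ × ℂ, ∃ ℓ : ℂ × ℂ →L[ℝ] ℝ,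
      HasDerivAt (F u v) V τ ∧ HasFDerivAt H ℓ (F u v τ) ∧ ∀ w, symplForm V w = ℓ w) :
    HamiltonianIsotopic symplForm U (Set.range fun x : Circle × Circle => F x.1 x.2 0)
      (Set.range fun x : Circle × Circle => F x.1 x.2 1) := by
  refine HamiltonianIsotopic.of_compact_family (c := fun (x : Circle × Circle) τ => F x.1 x.2 τ)
    (fun u v => (symplFormL_apply u v).symm) symplFormL_symplDual symplDual_symplFormL hU hO hH
    (fun x τ hτ => ?_) (fun x τ hτ => hmem _ _ _ x.1.norm_coe x.2.norm_coe hτ.1 hτ.2)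
    (fun x τ hτ => hflow _ _ _ x.1.norm_coe x.2.norm_coe hτ.1 hτ.2)
  have hc : Continuous fun p : (Circle × Circle) × ℝ => ((p.1.1 : ℂ), (p.1.2 : ℂ), p.2) := by
    fun_prop
  exact ContinuousAt.comp (f := fun p : (Circle × Circle) × ℝ => ((p.1.1 : ℂ), (p.1.2 : ℂ), p.2))
    (x := (x, τ)) (hF _ _ _ x.1.norm_coe x.2.norm_coe hτ.1 hτ.2).continuousAt hc.continuousAt

theorem hasFDerivAt_re_dir {z : ℂ} (hz : z ≠ 0) :
    HasFDerivAt (fun z => (dir z).re) (-(dir z).im • dAngle z) z := by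
  refine (Complex.reCLM.hasFDerivAt.comp z (hasFDerivAt_dir hz)).congr_fderiv ?_
  ext w
  simp [mul_comm]

theorem hasFDerivAt_im_dir {z : ℂ} (hz : z ≠ 0) :
    HasFDerivAt (fun z => (dir z).im) ((dir z).re • dAngle z) z := by
  refine (Complex.imCLM.hasFDerivAt.comp z (hasFDerivAt_dir hz)).congr_fderiv ?_
  ext w
  simp [mul_comm]

section Stages

variable {ε : ℝ} (h0 : 0 < ε) (h1 : ε ≤ 1 / 10) {a b : ℝ} (ha : 1 + 3 * ε ≤ a)
  (hb : 2 + ε / 10 ≤ b)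

include h0 h1 ha hb

/-- The first stage: a notch is cut into the second circle. The Hamiltonian is a multiple of the
angle of `1 + q u`, where `u` is the direction of the second coordinate. -/
theorem hamiltonianIsotopic_notch : HamiltonianIsotopic symplForm (polydisk a b)
    (productTorus 1 1)
    (Set.range fun x : Circle × Circle => (polarPt 1 x.1, notchedPt ε x.2)) := by
  have h1' : ε ≤ 1 := by linarith
  have hpos : ∀ v τ, ‖v‖ = 1 → 0 ≤ τ → τ ≤ 1 → 0 < 1 + τ * (ε / 400 * notchKernel ε v) ∧
      1 + τ * (ε / 400 * notchKernel ε v) ≤ 1 + ε / 800 := by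
    intro v τ hv hτ0 hτ1
    have := notchedArea_pos h0 h1' hv
    have h3 := (notchedArea_bounds h0 h1' hv).2
    unfold notchedArea at this h3
    constructor
    · by_cases hs : 0 ≤ ε / 400 * notchKernel ε v
      · positivity
      · nlinarith
    · by_cases hs : 0 ≤ ε / 400 * notchKernel ε v <;> nlinarith
  have key := hamiltonianIsotopic_torusFamily (isOpen_polydisk a b)
    (O := {z : ℂ × ℂ | z.2 ≠ 0}) (isOpen_ne.preimage continuous_snd)
    (H := fun z => ε / 400 / (2 * Real.pi) * Complex.arg (1 + notchRatio ε * dir z.2))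
    (F := fun u v τ => (polarPt 1 u, polarPt (1 + τ * (ε / 400 * notchKernel ε v)) v))
    ?_ ?_ ?_ ?_
  · convert key using 1
    · ext z
      constructor
      · rintro ⟨e1, e2⟩
        obtain ⟨u, hu⟩ := exists_polarPt_of_area one_pos e1
        obtain ⟨v, hv⟩ := exists_polarPt_of_area one_pos e2
        exact ⟨(u, v), by simp [← hu, ← hv]⟩
      · rintro ⟨x, rfl⟩
        refine ⟨area_polarPt zero_le_one x.1.norm_coe, ?_⟩
        simp only [zero_mul, add_zero]
        exact area_polarPt zero_le_one x.2.norm_coe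
    · simp only [one_mul]
      rfl
  · intro z hz
    have hd : ContDiffAt ℝ ∞ (fun z : ℂ × ℂ => 1 + notchRatio ε * dir z.2) z :=
      contDiffAt_const.add (contDiffAt_const.mul ((contDiffAt_dir hz).comp z contDiffAt_snd))
    exact (contDiffAt_const.mul ((contDiffAt_arg (one_add_notchRatio_mul_mem h0 h1'
      (norm_dir hz))).comp z hd)).contDiffWithinAt
  · intro u v τ hu hv hτ0 hτ1
    have cu : ContDiffAt ℝ ∞ (fun p : ℂ × ℂ × ℝ => p.1) (u, v, τ) := contDiffAt_fst
    have cv : ContDiffAt ℝ ∞ (fun p : ℂ × ℂ × ℝ => p.2.1) (u, v, τ) :=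
      contDiff_fst.contDiffAt.comp _ contDiffAt_snd
    have cτ : ContDiffAt ℝ ∞ (fun p : ℂ × ℂ × ℝ => p.2.2) (u, v, τ) :=
      contDiff_snd.contDiffAt.comp _ contDiffAt_snd
    have cn : ContDiffAt ℝ ∞ (fun p : ℂ × ℂ × ℝ => ε / 400 * notchKernel ε p.2.1) (u, v, τ) := by
      have := (contDiffAt_notchedArea h0 h1' cv hv).sub (contDiffAt_const (c := (1 : ℝ)))
      simpa only [notchedArea, add_sub_cancel_left] using this
    exact (contDiffAt_polarPt contDiffAt_const cu one_pos).prodMk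
      (contDiffAt_polarPt (contDiffAt_const.add (cτ.mul cn)) cv (hpos v τ hv hτ0 hτ1).1)
  · intro u v τ hu hv hτ0 hτ1
    obtain ⟨p1, p2⟩ := hpos v τ hv hτ0 hτ1
    refine ⟨⟨?_, ?_⟩, polarPt_ne_zero p1 hv⟩
    · rw [area_polarPt zero_le_one hu]; linarith
    · rw [area_polarPt p1.le hv]; linarith
  · intro u v τ hu hv hτ0 hτ1
    obtain ⟨p1, p2⟩ := hpos v τ hv hτ0 hτ1
    obtain ⟨V, hV, hVw⟩ := hasDerivAt_radial hv p1
    have hz := polarPt_ne_zero p1 hv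
    have hdir := dir_polarPt p1 hv
    have hs := one_add_notchRatio_mul_mem h0 h1' (norm_dir hz)
    have hd := ((hasFDerivAt_dir hz).const_mul (notchRatio ε : ℂ)).const_add 1
    have hH := (HasFDerivAt.comp (f := fun z => 1 + notchRatio ε * dir z) _ (hasFDerivAt_arg hs)
      hd).const_mul (ε / 400 / (2 * Real.pi))
    refine ⟨(0, V), _, (hasDerivAt_const τ _).prodMk hV,
      HasFDerivAt.comp (f := Prod.snd) (polarPt 1 u, polarPt (1 + τ * (ε / 400 * notchKernel ε v)) v)
        hH hasFDerivAt_snd, fun w => ?_⟩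
    have hk : ∀ t : ℝ, notchRatio ε * dAngle (1 + notchRatio ε * v) (t * (Complex.I * v))
        = t * notchKernel ε v := by
      intro t
      rw [dAngle_eq_im, notchKernel, ← Complex.re_ofReal_mul, ← Complex.im_ofReal_mul,
        div_eq_inv_mul]
      have : (notchRatio ε : ℂ) * ((1 + (notchRatio ε : ℂ) * v)⁻¹ * (t * (Complex.I * v)))
          = Complex.I * (t * ((1 + (notchRatio ε : ℂ) * v)⁻¹ * (notchRatio ε * v))) := by ring
      rw [this, Complex.I_mul_im]
    rw [symplForm, hVw]
    simp [hdir, hk, areaForm]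
    ring

/-- The second stage: the notched curve is shifted off the half-line `(-∞, 0]`,
by a translation. -/
theorem hamiltonianIsotopic_shift : HamiltonianIsotopic symplForm (polydisk a b)
    (Set.range fun x : Circle × Circle => (polarPt 1 x.1, notchedPt ε x.2))
    (Set.range fun x : Circle × Circle => (polarPt 1 x.1, slitPt ε x.2)) := by
  have h1' : ε ≤ 1 := by linarith
  have key := hamiltonianIsotopic_torusFamily (isOpen_polydisk a b) (O := Set.univ) isOpen_univ
    (H := fun z => notchShift ε * z.2.im)
    (F := fun u v τ => (polarPt 1 u, notchedPt ε v + ((τ * notchShift ε : ℝ) : ℂ)))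
    ?_ ?_ ?_ ?_
  · convert key using 1
    · simp
    · simp only [one_mul]
      rfl
  · exact (contDiff_const.mul (Complex.imCLM.contDiff.comp contDiff_snd)).contDiffOn
  · intro u v τ hu hv hτ0 hτ1
    have cu : ContDiffAt ℝ ∞ (fun p : ℂ × ℂ × ℝ => p.1) (u, v, τ) := contDiffAt_fst
    have cv : ContDiffAt ℝ ∞ (fun p : ℂ × ℂ × ℝ => p.2.1) (u, v, τ) :=
      contDiff_fst.contDiffAt.comp _ contDiffAt_snd
    have cτ : ContDiffAt ℝ ∞ (fun p : ℂ × ℂ × ℝ => p.2.2) (u, v, τ) :=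
      contDiff_snd.contDiffAt.comp _ contDiffAt_snd
    exact (contDiffAt_polarPt contDiffAt_const cu one_pos).prodMk
      ((contDiffAt_notchedPt h0 h1' cv hv).add (contDiffAt_ofReal (cτ.mul contDiffAt_const)))
  · intro u v τ hu hv hτ0 hτ1
    refine ⟨⟨?_, ?_⟩, trivial⟩
    · rw [area_polarPt zero_le_one hu]; linarith
    · have := area_shift_notchedPt_lt h0 h1' hv hτ0 hτ1
      refine this.trans ?_
      linarith
  · intro u v τ hu hv hτ0 hτ1
    have hV : HasDerivAt (fun τ : ℝ => notchedPt ε v + ((τ * notchShift ε : ℝ) : ℂ))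
        ((1 * notchShift ε : ℝ) : ℂ) τ :=
      (((hasDerivAt_id τ).mul_const _).ofReal_comp).const_add _
    refine ⟨(0, _), _, (hasDerivAt_const τ _).prodMk hV,
      ((Complex.imCLM.hasFDerivAt.comp _ hasFDerivAt_snd).const_mul _), fun w => ?_⟩
    simp [symplForm, areaForm]

/-- The third stage: the second coordinate is pushed outwards by an area that depends on the
direction of the first coordinate. The half-line `(-∞, 0]` is avoided, so that the angle of the
second coordinate is available to write down the Hamiltonian. -/
theorem hamiltonianIsotopic_push : HamiltonianIsotopic symplForm (polydisk a b)
    (Set.range fun x : Circle × Circle => (polarPt 1 x.1, slitPt ε x.2))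
    (Set.range fun x : Circle × Circle => twistPt ε x.1 (slitPt ε x.2) 0) := by
  have h1' : ε ≤ 1 := by linarith
  have hin : ∀ u v τ, ‖u‖ = 1 → 0 ≤ τ → τ ≤ 1 → 0 < pushShift ε u (slitPt ε v) τ ∧
      pushShift ε u (slitPt ε v) τ < a := by
    intro u v τ hu hτ0 hτ1
    have := abs_le.1 (pushShift_bounds (z := slitPt ε v) h0 hu hτ0 hτ1)
    constructor <;> linarith
  have hout : ∀ u v τ, ‖u‖ = 1 → ‖v‖ = 1 → 0 ≤ τ → τ ≤ 1 →
      0 < Real.pi * ‖slitPt ε v‖ ^ 2 + τ * pushArea ε u ∧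
      Real.pi * ‖slitPt ε v‖ ^ 2 + τ * pushArea ε u < b := by
    intro u v τ hu hv hτ0 hτ1
    obtain ⟨-, s2, s3⟩ := slitPt_facts h0 h1 hv
    obtain ⟨p1, p2⟩ := pushArea_bounds h0 hu
    have := norm_pos_iff.2 s2
    have hpi := Real.pi_pos
    have hp : 0 < Real.pi * ‖slitPt ε v‖ ^ 2 := by positivity
    constructor <;> nlinarith
  have key := hamiltonianIsotopic_torusFamily (isOpen_polydisk a b)
    (O := {z : ℂ × ℂ | z.1 ≠ 0} ∩ {z : ℂ × ℂ | z.2 ∈ Complex.slitPlane})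
    ((isOpen_ne.preimage continuous_fst).inter
      (Complex.isOpen_slitPlane.preimage continuous_snd))
    (H := fun z => pushArea ε (dir z.1) * Complex.arg z.2 / (2 * Real.pi))
    (F := fun u v τ => (polarPt (pushShift ε u (slitPt ε v) τ) u,
      polarPt (Real.pi * ‖slitPt ε v‖ ^ 2 + τ * pushArea ε u) (dir (slitPt ε v))))
    ?_ ?_ ?_ ?_
  · convert key using 1
    · congr 1
      funext x
      rw [pushShift, zero_mul, zero_mul, add_zero, add_zero,
        polarPt_area_dir (slitPt_facts h0 h1 x.2.norm_coe).2.1]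
    · congr 1
      funext x
      simp only [twistPt, innerArea, outerArea, zero_mul, add_zero, one_mul, Complex.ofReal_zero,
        Complex.exp_zero]
  · rintro z ⟨hz1, hz2⟩
    exact (((contDiffAt_pushArea ((contDiffAt_dir hz1).comp z contDiffAt_fst)).mul
      ((contDiffAt_arg hz2).comp z contDiffAt_snd)).div_const _).contDiffWithinAt
  · intro u v τ hu hv hτ0 hτ1
    have cu : ContDiffAt ℝ ∞ (fun p : ℂ × ℂ × ℝ => p.1) (u, v, τ) := contDiffAt_fst
    have cv : ContDiffAt ℝ ∞ (fun p : ℂ × ℂ × ℝ => p.2.1) (u, v, τ) :=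
      contDiff_fst.contDiffAt.comp _ contDiffAt_snd
    have cτ : ContDiffAt ℝ ∞ (fun p : ℂ × ℂ × ℝ => p.2.2) (u, v, τ) :=
      contDiff_snd.contDiffAt.comp _ contDiffAt_snd
    have cz : ContDiffAt ℝ ∞ (fun p : ℂ × ℂ × ℝ => slitPt ε p.2.1) (u, v, τ) :=
      contDiffAt_slitPt h0 h1' cv hv
    obtain ⟨s1, s2, -⟩ := slitPt_facts h0 h1 hv
    have cd : ContDiffAt ℝ ∞ (fun p : ℂ × ℂ × ℝ => dir (slitPt ε p.2.1)) (u, v, τ) :=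
      ContDiffAt.comp (g := dir) (f := fun p : ℂ × ℂ × ℝ => slitPt ε p.2.1) (u, v, τ)
        (contDiffAt_dir s2) cz
    exact (contDiffAt_polarPt (contDiffAt_pushShift cu cz cτ s1) cu
      (hin u v τ hu hτ0 hτ1).1).prodMk
      (contDiffAt_polarPt ((contDiffAt_area cz).add (cτ.mul (contDiffAt_pushArea cu))) cd
        (hout u v τ hu hv hτ0 hτ1).1)
  · intro u v τ hu hv hτ0 hτ1
    obtain ⟨p1, p2⟩ := hin u v τ hu hτ0 hτ1
    obtain ⟨p3, p4⟩ := hout u v τ hu hv hτ0 hτ1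
    obtain ⟨s1, s2, -⟩ := slitPt_facts h0 h1 hv
    refine ⟨⟨?_, ?_⟩, polarPt_ne_zero p1 hu, polarPt_mem_slitPlane p3 (dir_mem_slitPlane s1)⟩
    · rwa [area_polarPt p1.le hu]
    · rwa [area_polarPt p3.le (norm_dir s2)]
  · intro u v τ hu hv hτ0 hτ1
    have p1 := (hin u v τ hu hτ0 hτ1).1
    have p3 := (hout u v τ hu hv hτ0 hτ1).1
    obtain ⟨s1, s2, -⟩ := slitPt_facts h0 h1 hv
    have q1 := polarPt_ne_zero p1 hu
    have q2 := polarPt_mem_slitPlane p3 (dir_mem_slitPlane s1)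
    obtain ⟨V, hV, hVw⟩ := hasDerivAt_radial hu p1
    obtain ⟨V', hV', hVw'⟩ := hasDerivAt_radial (norm_dir s2) p3
    set Q₁ := polarPt (pushShift ε u (slitPt ε v) τ) u
    set Q₂ := polarPt (Real.pi * ‖slitPt ε v‖ ^ 2 + τ * pushArea ε u) (dir (slitPt ε v))
    have hD : dir Q₁ = u := dir_polarPt p1 hu
    have hA : Complex.arg Q₂ = Complex.arg (slitPt ε v) := by rw [arg_polarPt p3, arg_dir s2]
    have hVQ : ∀ w, areaForm V w = -(ε / 20 * u.im * Complex.arg (slitPt ε v)) / (2 * Real.pi) *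
        dAngle Q₁ w := hVw
    have d1 := ((hasFDerivAt_re_dir q1).const_mul (ε / 20)).const_add (1 - ε / 200)
    have d1' := HasFDerivAt.comp (f := Prod.fst) (Q₁, Q₂) d1 hasFDerivAt_fst
    have d2 := HasFDerivAt.comp (f := Prod.snd) (Q₁, Q₂) (hasFDerivAt_arg q2) hasFDerivAt_snd
    refine ⟨(V, V'), _, hV.prodMk hV', (d1'.mul d2).mul_const (2 * Real.pi)⁻¹, fun w => ?_⟩
    rw [symplForm, hVQ, hVw']
    clear_value Q₁ Q₂
    simp [hD, hA, pushArea]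
    ring

/-- The fourth stage: the second coordinate is rotated by an angle that depends on the direction
of the first coordinate. -/
theorem hamiltonianIsotopic_twist : HamiltonianIsotopic symplForm (polydisk a b)
    (Set.range fun x : Circle × Circle => twistPt ε x.1 (slitPt ε x.2) 0)
    (Set.range (twistedTorus ε)) := by
  have h1' : ε ≤ 1 := by linarith
  have key := hamiltonianIsotopic_torusFamily (isOpen_polydisk a b)
    (O := {z : ℂ × ℂ | z.1 ≠ 0}) (isOpen_ne.preimage continuous_fst)
    (H := fun z => -(twistAngle ε (dir z.1) * (Real.pi * ‖z.2‖ ^ 2 - 3 / 2) +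
      ε * (dir z.1).im) / (2 * Real.pi))
    (F := fun u v τ => twistPt ε u (slitPt ε v) τ) ?_ ?_ ?_ ?_
  · convert key using 1
    ext p
    constructor
    · rintro ⟨x, rfl⟩
      exact ⟨(⟨turn x.1, mem_sphere_zero_iff_norm.2 (norm_turn _)⟩,
        ⟨turn x.2, mem_sphere_zero_iff_norm.2 (norm_turn _)⟩), rfl⟩
    · rintro ⟨x, rfl⟩
      obtain ⟨s, hs⟩ := exists_turn_eq x.1.norm_coe
      obtain ⟨t, ht⟩ := exists_turn_eq x.2.norm_coe
      exact ⟨(s, t), by simp [twistedTorus, hs, ht]⟩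
  · intro z hz
    have cd : ContDiffAt ℝ ∞ (fun z : ℂ × ℂ => dir z.1) z :=
      (contDiffAt_dir hz).comp z contDiffAt_fst
    exact (((((contDiffAt_twistAngle cd).mul ((contDiffAt_area contDiffAt_snd).sub
      contDiffAt_const)).add (contDiffAt_const.mul (contDiffAt_im cd))).neg).div_const
      _).contDiffWithinAt
  · intro u v τ hu hv hτ0 hτ1
    have cu : ContDiffAt ℝ ∞ (fun p : ℂ × ℂ × ℝ => p.1) (u, v, τ) := contDiffAt_fst
    have cv : ContDiffAt ℝ ∞ (fun p : ℂ × ℂ × ℝ => p.2.1) (u, v, τ) :=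
      contDiff_fst.contDiffAt.comp _ contDiffAt_snd
    have cτ : ContDiffAt ℝ ∞ (fun p : ℂ × ℂ × ℝ => p.2.2) (u, v, τ) :=
      contDiff_snd.contDiffAt.comp _ contDiffAt_snd
    exact contDiffAt_twistPt cu (contDiffAt_slitPt h0 h1' cv hv) cτ (slitPt_facts h0 h1 hv).1
      (innerArea_slitPt_pos h0 h1 hu hv hτ0 hτ1) (outerArea_slitPt_pos h0 h1 hu hv)
  · intro u v τ hu hv hτ0 hτ1
    obtain ⟨-, s2, s3⟩ := slitPt_facts h0 h1 hv
    have i := abs_lt.1 (innerArea_bounds h0 h1 hu s2 s3 hτ0 hτ1)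
    have o := outerArea_bounds h0 hu s2 s3
    have i' := innerArea_slitPt_pos h0 h1 hu hv hτ0 hτ1
    refine ⟨⟨?_, ?_⟩, polarPt_ne_zero i' hu⟩
    · rw [twistPt, area_polarPt i'.le hu]; linarith
    · rw [twistPt, area_polarPt (outerArea_slitPt_pos h0 h1 hu hv).le (norm_exp_mul_dir _ s2)]
      linarith
  · intro u v τ hu hv hτ0 hτ1
    obtain ⟨-, s2, s3⟩ := slitPt_facts h0 h1 hv
    have p1 := innerArea_slitPt_pos h0 h1 hu hv hτ0 hτ1
    have p2 := outerArea_slitPt_pos h0 h1 hu hv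
    have q1 := polarPt_ne_zero p1 hu
    obtain ⟨V, hV, hVw⟩ := hasDerivAt_radial hu p1
    have dv : HasDerivAt (fun s : ℝ => Complex.exp ((s * twistAngle ε u : ℝ) * Complex.I) *
        dir (slitPt ε v)) ((twistAngle ε u : ℝ) *
          (Complex.I * (Complex.exp ((τ * twistAngle ε u : ℝ) * Complex.I) *
            dir (slitPt ε v)))) τ := by
      refine (((((hasDerivAt_id τ).mul_const (twistAngle ε u)).ofReal_comp).mul_const
        Complex.I).cexp.mul_const _).congr_deriv ?_
      push_cast
      simp only [id]
      ring
    have hV' := hasDerivAt_polarPt (hasDerivAt_const τ (outerArea ε u (slitPt ε v))) dv p2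
    set P := twistPt ε u (slitPt ε v) τ
    have hVP : ∀ w, areaForm V w = twistRate ε u (slitPt ε v) / (2 * Real.pi) * dAngle P.1 w := hVw
    have dre : HasFDerivAt _ _ P.1 := hasFDerivAt_re_dir q1
    have dim : HasFDerivAt _ _ P.1 := hasFDerivAt_im_dir q1
    have dW : HasFDerivAt (fun z : ℂ × ℂ => twistAngle ε (dir z.1)) _ P :=
      HasFDerivAt.comp (f := Prod.fst) P ((dre.mul dim).const_mul (-ε)) hasFDerivAt_fst
    have dI : HasFDerivAt (fun z : ℂ × ℂ => ε * (dir z.1).im) _ P :=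
      HasFDerivAt.comp (f := Prod.fst) P (dim.const_mul ε) hasFDerivAt_fst
    have dN : HasFDerivAt (fun z : ℂ × ℂ => Real.pi * ‖z.2‖ ^ 2 - 3 / 2) _ P :=
      ((HasFDerivAt.norm_sq hasFDerivAt_snd).const_mul Real.pi).sub_const (3 / 2)
    refine ⟨(V, _), _, hV.prodMk hV', ((dW.mul dN).add dI).neg.mul_const (2 * Real.pi)⁻¹,
      fun w => ?_⟩
    have hA : Real.pi * ‖P.2‖ ^ 2 = outerArea ε u (slitPt ε v) :=
      area_polarPt p2.le (norm_exp_mul_dir _ s2)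
    have hD : dir P.1 = u := dir_polarPt p1 hu
    have hP2 : polarPt (outerArea ε u (slitPt ε v))
      (Complex.exp ((τ * twistAngle ε u : ℝ) * Complex.I) * dir (slitPt ε v)) = P.2 := rfl
    have hpi := Real.pi_ne_zero
    rw [symplForm, hVP]
    simp only [hP2]
    clear_value P
    simp [hA, hD, areaForm, twistRate, Complex.inner]
    field_simp
    ring

/-- The twisted torus is Hamiltonian isotopic to the product torus. -/
theorem hamiltonianIsotopic_twistedTorus :
    HamiltonianIsotopic symplForm (polydisk a b) (productTorus 1 1)
      (Set.range (twistedTorus ε)) := by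
  have hΩ : ∀ u v, symplForm u v = symplFormL u v := fun u v => (symplFormL_apply u v).symm
  exact (((hamiltonianIsotopic_notch h0 h1 ha hb).trans hΩ
    (hamiltonianIsotopic_shift h0 h1 ha hb)).trans hΩ
    (hamiltonianIsotopic_push h0 h1 ha hb)).trans hΩ (hamiltonianIsotopic_twist h0 h1 ha hb)

end Stages

/-! ### The displaced circle -/

/-- The closed curve with area coordinate `1 + k Re u` in direction `u`. -/
noncomputable def displacedCircle (k : ℝ) : Set ℂ :=
  Set.range fun u : Circle => polarPt (1 + k * (u : ℂ).re) u

theorem one_add_mul_re_bounds {k : ℝ} (hk0 : 0 < k) {u : ℂ} (hu : ‖u‖ = 1) {τ : ℝ}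
    (hτ0 : 0 ≤ τ) (hτ1 : τ ≤ 1) : |τ * (k * u.re)| ≤ k := by
  rw [abs_mul, abs_mul, abs_of_nonneg hτ0, abs_of_pos hk0]
  have h1 : |u.re| ≤ 1 := hu ▸ Complex.abs_re_le_norm u
  calc τ * (k * |u.re|) ≤ 1 * (k * 1) := by gcongr
    _ = k := by ring

theorem areaCircle_one_eq_range : areaCircle 1 = Set.range fun u : Circle => polarPt 1 u := by
  ext z
  constructor
  · intro hz
    obtain ⟨u, hu⟩ := exists_polarPt_of_area one_pos hz
    exact ⟨u, hu.symm⟩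
  · rintro ⟨u, rfl⟩
    exact area_polarPt zero_le_one u.norm_coe

section DisplacedCircle

variable {k : ℝ} (hk0 : 0 < k) (hk1 : k < 1)

include hk0 hk1

theorem displacedArea_pos {u : ℂ} (hu : ‖u‖ = 1) : 0 < 1 + k * u.re := by
  have := abs_le.1 (one_add_mul_re_bounds hk0 hu zero_le_one le_rfl)
  linarith

theorem hamiltonianIsotopic_displacedCircle {a δ : ℝ} (ha : 1 + k < a) (hδ : k < δ) :
    HamiltonianIsotopic areaForm (areaDisk a ∩ {z | |Real.pi * ‖z‖ ^ 2 - 1| < δ}) (areaCircle 1)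
      (displacedCircle k) := by
  have hpos : ∀ (u : Circle) (τ : ℝ), 0 ≤ τ → τ ≤ 1 → 0 < 1 + τ * (k * (u : ℂ).re) := by
    intro u τ hτ0 hτ1
    have := abs_le.1 (one_add_mul_re_bounds hk0 u.norm_coe hτ0 hτ1)
    linarith
  have hU : IsOpen (areaDisk a ∩ {z | |Real.pi * ‖z‖ ^ 2 - 1| < δ}) :=
    (isOpen_lt (f := fun z : ℂ => Real.pi * ‖z‖ ^ 2) (by fun_prop) continuous_const).inter
      (isOpen_lt (by fun_prop) continuous_const)
  have key := HamiltonianIsotopic.of_compact_family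
    (fun u v => (areaFormL_apply u v).symm) areaFormL_areaDual areaDual_areaFormL hU
    (O := {z : ℂ | z ≠ 0}) isOpen_ne (H := fun z => k / (2 * Real.pi) * (dir z).im)
    (c := fun (u : Circle) τ => polarPt (1 + τ * (k * (u : ℂ).re)) u) ?_ ?_ ?_ ?_
  · convert key using 1
    · rw [areaCircle_one_eq_range]
      simp
    · simp only [one_mul]
      rfl
  · intro z hz
    exact (contDiffAt_const.mul (contDiffAt_im (contDiffAt_dir hz))).contDiffWithinAt
  · intro u τ _
    exact continuousAt_polarPt (by fun_prop) (by fun_prop)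
  · intro u τ hτ
    have h1 := abs_le.1 (one_add_mul_re_bounds hk0 u.norm_coe hτ.1 hτ.2)
    have h2 := hpos u τ hτ.1 hτ.2
    refine ⟨⟨?_, ?_⟩, polarPt_ne_zero h2 u.norm_coe⟩
    · rw [areaDisk, Set.mem_ofPred_eq, area_polarPt h2.le u.norm_coe]; linarith
    · rw [Set.mem_ofPred_eq, area_polarPt h2.le u.norm_coe, add_sub_cancel_left, abs_lt]
      constructor <;> linarith
  · intro u τ hτ
    have h2 := hpos u τ hτ.1 hτ.2
    obtain ⟨V, hV, hVw⟩ := hasDerivAt_radial u.norm_coe h2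
    refine ⟨V, _, hV, (hasFDerivAt_im_dir (polarPt_ne_zero h2 u.norm_coe)).const_mul _,
      fun w => ?_⟩
    rw [hVw]
    simp [dir_polarPt h2 u.norm_coe]
    ring

theorem areaCircle_inter_displacedCircle :
    areaCircle 1 ∩ displacedCircle k = {polarPt 1 Complex.I, polarPt 1 (-Complex.I)} := by
  ext z
  constructor
  · rintro ⟨hz, u, rfl⟩
    have hn := u.norm_coe
    have h1 := area_polarPt (displacedArea_pos hk0 hk1 hn).le hn
    have h2 : Real.pi * ‖polarPt (1 + k * (u : ℂ).re) u‖ ^ 2 = 1 := hz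
    have hre : (u : ℂ).re = 0 := by
      have : k * (u : ℂ).re = 0 := by linarith
      exact (mul_eq_zero.1 this).resolve_left hk0.ne'
    have him : (u : ℂ).im = 1 ∨ (u : ℂ).im = -1 := by
      have := re_sq_add_im_sq hn
      rw [hre] at this
      exact sq_eq_one_iff.1 (by linarith)
    simp only [hre, mul_zero, add_zero]
    rcases him with h | h
    · left
      congr 1
      exact Complex.ext (by simp [hre]) (by simp [h])
    · right
      rw [Set.mem_singleton_iff]
      congr 1
      exact Complex.ext (by simp [hre]) (by simp [h])
  · have : ∀ v : ℂ, ‖v‖ = 1 → v.re = 0 → polarPt 1 v ∈ areaCircle 1 ∩ displacedCircle k := by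
      intro v hv hre
      exact ⟨area_polarPt zero_le_one hv, ⟨v, mem_sphere_zero_iff_norm.2 hv⟩, by simp [hre]⟩
    rintro (rfl | rfl)
    · exact this _ (by simp) (by simp)
    · exact this _ (by simp) (by simp)

theorem ncard_areaCircle_inter_displacedCircle :
    (areaCircle 1 ∩ displacedCircle k).ncard = 2 := by
  rw [areaCircle_inter_displacedCircle hk0 hk1]
  refine Set.ncard_pair fun h => ?_
  have := congrArg dir h
  rw [dir_polarPt one_pos (by simp), dir_polarPt one_pos (by simp)] at this
  have := congrArg Complex.im this
  norm_num at this

end DisplacedCircle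

/-- The velocity at time `0` of a curve in polar coordinates. -/
theorem polarPt_mem_tangentVectors {S : Set ℂ} {m : ℝ → ℝ} {m' t₀ s : ℝ} (hm : ContDiff ℝ ∞ m)
    (hpos : ∀ t, 0 < m t) (hm' : HasDerivAt m m' 0)
    (hS : ∀ t, polarPt (m t) (turn (t₀ + t * s)) ∈ S) :
    ((m' / (2 * m 0) : ℝ) + (2 * Real.pi * s : ℝ) * Complex.I) * polarPt (m 0) (turn t₀) ∈
      tangentVectors S (polarPt (m 0) (turn t₀)) := by
  have ht : HasDerivAt (fun t : ℝ => t₀ + t * s) s 0 := by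
    simpa using ((hasDerivAt_id (0 : ℝ)).mul_const s).const_add t₀
  refine ⟨fun t => polarPt (m t) (turn (t₀ + t * s)), ?_, by simp, ?_,
    Filter.Eventually.of_forall hS⟩
  · rw [contDiff_iff_contDiffAt]
    intro t
    have hu : ContDiff ℝ ∞ fun t : ℝ => turn (t₀ + t * s) := contDiff_turn.comp (by fun_prop)
    exact contDiffAt_polarPt hm.contDiffAt hu.contDiffAt (hpos t)
  · have := (hasDerivAt_polarPt hm' (hasDerivAt_turn ht) (hpos 0)).deriv
    rw [this]
    simp

theorem intersectTransversely_displacedCircle {k : ℝ} (hk0 : 0 < k) (hk1 : k < 1) :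
    IntersectTransversely (areaCircle 1) (displacedCircle k) := by
  intro p hp w
  obtain ⟨v, hv, hre, him, rfl⟩ : ∃ v : ℂ, ‖v‖ = 1 ∧ v.re = 0 ∧ v.im ≠ 0 ∧ p = polarPt 1 v := by
    rw [areaCircle_inter_displacedCircle hk0 hk1] at hp
    rcases hp with rfl | rfl
    · exact ⟨_, by simp, by simp, by simp, rfl⟩
    · exact ⟨_, by simp, by simp, by simp, rfl⟩
  obtain ⟨t₀, rfl⟩ := exists_turn_eq hv
  have hp0 := polarPt_ne_zero one_pos hv
  have hpi := Real.pi_ne_zero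
  -- the radial part of `w` has to come from the second curve
  set x := (w / polarPt 1 (turn t₀)).re with hx
  set y := (w / polarPt 1 (turn t₀)).im with hy
  set s₂ : ℝ := -x / (Real.pi * k * (turn t₀).im) with hs₂
  have h1 : ∀ s : ℝ, ((2 * Real.pi * s : ℝ) * Complex.I) * polarPt 1 (turn t₀) ∈
      tangentVectors (areaCircle 1) (polarPt 1 (turn t₀)) := by
    intro s
    have := polarPt_mem_tangentVectors (S := areaCircle 1) (m := fun _ => 1) (t₀ := t₀) (s := s)
      contDiff_const (fun _ => one_pos) (hasDerivAt_const _ _)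
      (fun t => area_polarPt zero_le_one (norm_turn _))
    simpa using this
  have h2 : ((x : ℂ) + (2 * Real.pi * s₂ : ℝ) * Complex.I) * polarPt 1 (turn t₀) ∈
      tangentVectors (displacedCircle k) (polarPt 1 (turn t₀)) := by
    have ht : HasDerivAt (fun t : ℝ => t₀ + t * s₂) s₂ 0 := by
      simpa using ((hasDerivAt_id (0 : ℝ)).mul_const s₂).const_add t₀
    have dm := ((Complex.reCLM.hasFDerivAt.comp_hasDerivAt (0 : ℝ)
      (hasDerivAt_turn ht)).const_mul k).const_add 1
    have hu : ContDiff ℝ ∞ fun t : ℝ => turn (t₀ + t * s₂) := contDiff_turn.comp (by fun_prop)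
    have := polarPt_mem_tangentVectors (S := displacedCircle k) (t₀ := t₀) (s := s₂)
      (m := fun t => 1 + k * (turn (t₀ + t * s₂)).re)
      (contDiff_const.add (contDiff_const.mul (Complex.reCLM.contDiff.comp hu)))
      (fun t => displacedArea_pos hk0 hk1 (norm_turn _)) dm
      (fun t => ⟨⟨turn (t₀ + t * s₂), mem_sphere_zero_iff_norm.2 (norm_turn _)⟩, rfl⟩)
    simp only [zero_mul, add_zero, hre, mul_zero] at this
    have hx2 : k * Complex.reCLM ((2 * Real.pi * s₂ : ℝ) * (Complex.I * turn t₀)) / (2 * 1) = x := by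
      rw [Complex.reCLM_apply, Complex.re_ofReal_mul, Complex.I_mul_re, hs₂]
      field_simp
    rwa [hx2] at this
  refine ⟨_, h1 (y / (2 * Real.pi) - s₂), _, h2, ?_⟩
  rw [← add_mul]
  have : ((2 * Real.pi * (y / (2 * Real.pi) - s₂) : ℝ) : ℂ) * Complex.I +
      (x + (2 * Real.pi * s₂ : ℝ) * Complex.I) = w / polarPt 1 (turn t₀) := by
    rw [← Complex.re_add_im (w / polarPt 1 (turn t₀)), ← hx, ← hy]
    have : 2 * Real.pi * (y / (2 * Real.pi) - s₂) = y - 2 * Real.pi * s₂ := by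
      field_simp
    rw [this]
    push_cast
    ring
  rw [this, div_mul_cancel₀ _ hp0]

/-! ### The packing is not maximal -/

section Disjointness

variable {ε : ℝ} (h0 : 0 < ε) (h1 : ε ≤ 1 / 10)

include h0 h1

/-- Over the circle of area `1` the twisted torus stays outside a disk that contains the circle of
area `1` and, for small `k`, the displaced circle. -/
theorem le_area_fst_twistedTorus {x : ℝ × ℝ}
    (h : Real.pi * ‖(twistedTorus ε x).2‖ ^ 2 = 1) :
    1 + ε / 5 ≤ Real.pi * ‖(twistedTorus ε x).1‖ ^ 2 := by
  rw [area_snd_twistedTorus h0 h1] at h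
  rw [area_fst_twistedTorus h0 h1]
  exact innerArea_ge_of_outerArea_eq_one h0 (norm_turn _)
    (slitPt_facts h0 h1 (norm_turn x.2)).2.1 h

theorem disjoint_twistedTorus_productTorus {m n : ℕ} (hm : 1 ≤ m) (hn : 1 ≤ n) :
    Disjoint (Set.range (twistedTorus ε)) (productTorus m n) := by
  rw [Set.disjoint_left]
  rintro _ ⟨x, rfl⟩ ⟨e1, e2⟩
  obtain ⟨-, s2, s3⟩ := slitPt_facts h0 h1 (norm_turn x.2)
  have i := abs_lt.1 (innerArea_bounds h0 h1 (norm_turn x.1) s2 s3 zero_le_one le_rfl)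
  have o := outerArea_bounds h0 (norm_turn x.1) s2 s3
  rw [← area_fst_twistedTorus h0 h1, e1] at i
  rw [← area_snd_twistedTorus h0 h1, e2] at o
  have hm2 : m < 2 := by
    have : (m : ℝ) < (2 : ℕ) := by push_cast; linarith
    exact_mod_cast this
  have hn3 : n < 3 := by
    have : (n : ℝ) < (3 : ℕ) := by push_cast; linarith
    exact_mod_cast this
  obtain rfl : m = 1 := by omega
  obtain rfl | rfl : n = 1 ∨ n = 2 := by omega
  · have := le_area_fst_twistedTorus h0 h1 (x := x) (by simpa using e2)
    rw [e1] at this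
    push_cast at this
    linarith
  · rw [area_snd_twistedTorus h0 h1] at e2
    have := innerArea_le_of_outerArea_eq_two h0 (norm_turn x.1) s3 (by simpa using e2)
    rw [← area_fst_twistedTorus h0 h1, e1] at this
    push_cast at this
    linarith

theorem disjoint_twistedTorus_displacedCircle {k : ℝ} (hk0 : 0 < k) (hk : k < ε / 5) :
    Disjoint (Set.range (twistedTorus ε)) (displacedCircle k ×ˢ areaCircle 1) := by
  rw [Set.disjoint_left]
  rintro _ ⟨x, rfl⟩ ⟨⟨u, hu⟩, e2⟩
  have h := le_area_fst_twistedTorus h0 h1 e2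
  have hb := abs_le.1 (one_add_mul_re_bounds hk0 u.norm_coe zero_le_one le_rfl)
  simp only at hu
  rw [← hu, area_polarPt (by linarith) u.norm_coe] at h
  linarith

end Disjointness

theorem mainTheorem2 (a b : ℝ) (ha : 1 < a) (hb : 2 < b) :
    ¬ IsMaximalIntegralPacking a b ∧
    ∀ δ : ℝ, 0 < δ →
      ∃ C' : Set ℂ,
        HamiltonianIsotopic areaForm
          (areaDisk a ∩ {z | |Real.pi * ‖z‖ ^ 2 - 1| < δ}) (areaCircle 1) C' ∧
        IntersectTransversely (areaCircle 1) C' ∧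
        (areaCircle 1 ∩ C').ncard = 2 ∧
        ∃ L : Set (ℂ × ℂ),
          IsIntegralLagrangian (polydisk a b) L ∧
          HamiltonianIsotopic symplForm (polydisk a b) (productTorus 1 1) L ∧
          Disjoint L (C' ×ˢ areaCircle 1) ∧
          ∀ m n : ℕ, 1 ≤ m → 1 ≤ n → (m, n) ≠ (1, 1) → Disjoint L (productTorus m n) := by
  obtain ⟨ε, h0, hε⟩ : ∃ ε : ℝ, 0 < ε ∧ ε < min (1 / 10) (min ((a - 1) / 3) (b - 2)) :=
    exists_between (lt_min (by norm_num) (lt_min (by linarith) (by linarith)))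
  rw [lt_min_iff, lt_min_iff] at hε
  obtain ⟨h1, hεa, hεb⟩ := hε
  have ha' : 1 + 3 * ε ≤ a := by linarith
  have hb' : 2 + ε / 10 ≤ b := by linarith
  have hL := isIntegralLagrangian_twistedTorus h0 h1.le ha' hb'
  refine ⟨fun hmax => ?_, fun δ hδ => ?_⟩
  · obtain ⟨m, n, hm, hn, -, -, p, hp⟩ := hmax _ hL
    exact Set.disjoint_left.1 (disjoint_twistedTorus_productTorus h0 h1.le hm hn) hp.1 hp.2
  · obtain ⟨k, hk0, hk⟩ : ∃ k : ℝ, 0 < k ∧ k < min (ε / 5) δ :=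
      exists_between (lt_min (by linarith) hδ)
    rw [lt_min_iff] at hk
    have hk1 : k < 1 := by linarith
    exact ⟨displacedCircle k,
      hamiltonianIsotopic_displacedCircle hk0 hk1 (by linarith) hk.2,
      intersectTransversely_displacedCircle hk0 hk1,
      ncard_areaCircle_inter_displacedCircle hk0 hk1, _, hL,
      hamiltonianIsotopic_twistedTorus h0 h1.le ha' hb',
      disjoint_twistedTorus_displacedCircle h0 h1.le hk0 hk.1,
      fun m n hm hn _ => disjoint_twistedTorus_productTorus h0 h1.le hm hn⟩
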